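/- Let $\tau>0$ be a constant. There is a deterministic CONGEST algorithm that, on every $n$-node graph $G=(V,E)$ of arboricity $\alpha$ with $\alpha\ge 2^{3/\tau}$ (equivalently $\lfloor \frac{\tau}{3}\log_2\alpha\rfloor\ge 1$) and with node weights $w:V\to\mathbb{Q}_{\ge 0}$, computes an $\alpha^{1+\tau}$-approximation for maximum weight independent set (MWIS) in $O(\log\alpha\cdot\log n)$ rounds, where the constant in the $O$ depends only on $\tau$ and on the constant $c$ below. Here the arboricity of $G$ is the smallest integer $\alpha>0$ such that $E$ can be partitioned into $\alpha$ pairwise disjoint sets $E_1,\dots,E_\alpha$ with every $(V,E_i)$ a forest. A $q$-approximation for MWIS is an independent set $X\subseteq V$ with $q\cdot w(X)\ge OPT(G)$, where $w(X)=\sum_{v\in X}w(v)$ and $OPT(G)$ is the largest weight of an independent set of $G$. In the CONGEST model the nodes compute in synchronous rounds; in each round every node may send a message of $O(\log n)$ bits to each of its neighbors. Identifiers and weights are represented by $O(\log n)$ bits: for a constant $c$, the identifiers are distinct natural numbers at most $n^c$, and the weights are non-negative rationals whose numerators and denominators are at most $n^c$; the algorithm and the constant in the message size may depend on $\tau$ and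 $c$. Initially each node knows $n$, $\alpha$, its own identifier, its weight and its degree, and it can tell its incident links apart; local computation is unrestricted. The algorithm has terminated when every node has irrevocably decided whether it belongs to $X$. -/

import Mathlib

namespace Congest

/-- The edges of `G` can be partitioned into `k` pairwise disjoint sets, each of which is the edge
set of a forest on the same vertices. -/
def HasForestPartition {V : Type} (G : SimpleGraph V) (k : ℕ) : Prop :=
  ∃ F : Fin k → SimpleGraph V,
    (∀ i, (F i).IsAcyclic) ∧
    (∀ i j, i ≠ j → Disjoint (F i).edgeSet (F j).edgeSet) ∧
    (⋃ i, (F i).edgeSet) = G.edgeSet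

/-- The arboricity: the smallest integer `k > 0` such that the edges can be partitioned into `k`
forests. -/
noncomputable def arboricity {V : Type} (G : SimpleGraph V) : ℕ :=
  sInf {k : ℕ | 0 < k ∧ HasForestPartition G k}

open Classical in
/-- `OPT(G)`: the largest weight of an independent set. -/
noncomputable def opt {V : Type} [Fintype V] (G : SimpleGraph V) (w : V → ℚ≥0) : ℚ≥0 :=
  ((Finset.univ : Finset (Finset V)).filter fun Y => G.IsIndepSet (Y : Set V)).sup
    fun Y => ∑ v ∈ Y, w v

/-- `X` is a `q`-approximation for maximum weight independent set: an independent set with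
`q * w(X) ≥ OPT(G)`. -/
def IsApproxMWIS {V : Type} [Fintype V] (G : SimpleGraph V) (w : V → ℚ≥0) (q : ℝ)
    (X : Finset V) : Prop :=
  G.IsIndepSet (X : Set V) ∧ ((opt G w : ℚ≥0) : ℝ) ≤ q * ((∑ v ∈ X, w v : ℚ≥0) : ℝ)

/-- A node-weighted communication network: every node has a unique identifier and numbers its
incident links by `0, …, deg v - 1` in an arbitrary way. -/
structure Network (V : Type) where
  graph : SimpleGraph V
  ident : V → ℕ
  ident_injective : Function.Injective ident
  weight : V → ℚ≥0
  port : ∀ v : V, Fin (graph.neighborSet v).ncard ≃ graph.neighborSet v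

namespace Network

variable {V : Type}

noncomputable def degree (N : Network V) (v : V) : ℕ := (N.graph.neighborSet v).ncard

/-- Identifiers and weights are given by `O(log n)` bits, with constant `c`: identifiers are at
most `n ^ c`, and so are the numerators and the denominators of the weights. -/
def HasLogBits [Fintype V] (N : Network V) (c : ℕ) : Prop :=
  ∀ v, N.ident v ≤ Fintype.card V ^ c ∧
    (N.weight v).num ≤ Fintype.card V ^ c ∧ (N.weight v).den ≤ Fintype.card V ^ c

/-- If every node `u` sends `out u p` over its port `p`, then `N.inbox out v p` is what `v` receives
over its port `p` (and the empty string if there is no such port). -/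
noncomputable def inbox (N : Network V) (out : V → ℕ → List Bool) (v : V) (p : ℕ) : List Bool :=
  if h : p < (N.graph.neighborSet v).ncard then
    out (N.port v ⟨p, h⟩)
      ((N.port (N.port v ⟨p, h⟩)).symm ⟨v, (N.port v ⟨p, h⟩).2.symm⟩ : Fin _)
  else []

end Network

/-- Everything that a node knows before the first round. -/
structure LocalInput where
  numNodes : ℕ
  arboricity : ℕ
  ident : ℕ
  weight : ℚ≥0
  degree : ℕ

/-- A deterministic synchronous message passing algorithm. In every round a node that has not
halted sends a bit string over each port (the empty string stands for silence), and then updates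
its state from the bit strings received in that round. A node halts as soon as its state has an
output; the output says whether the node is in the computed set. -/
structure Algorithm where
  State : Type
  init : LocalInput → State
  send : State → ℕ → List Bool
  step : State → (ℕ → List Bool) → State
  output : State → Option Bool

namespace Algorithm

variable {V : Type}

/-- The message that a node in state `s` sends over port `p`; halted nodes are silent. -/
def message (A : Algorithm) (s : A.State) (p : ℕ) : List Bool :=
  if (A.output s).isSome then [] else A.send s p

/-- The state of each node after `t` rounds. -/
noncomputable def stateAfter [Fintype V] (A : Algorithm) (N : Network V) : ℕ → V → A.State
  | 0 => fun v => A.init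
      { numNodes := Fintype.card V
        arboricity := Congest.arboricity N.graph
        ident := N.ident v
        weight := N.weight v
        degree := N.degree v }
  | t + 1 => fun v =>
      if (A.output (stateAfter A N t v)).isSome then stateAfter A N t v
      else A.step (stateAfter A N t v)
        (N.inbox (fun u p => A.message (stateAfter A N t u) p) v)

/-- All nodes have halted after at most `T` rounds. -/
def HaltsWithin [Fintype V] (A : Algorithm) (N : Network V) (T : ℕ) : Prop :=
  ∀ v, (A.output (A.stateAfter N T v)).isSome

/-- The set of the nodes that have halted after `T` rounds with output `true`. -/
noncomputable def outputSet [Fintype V] (A : Algorithm) (N : Network V) (T : ℕ) : Finset V :=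
  Finset.univ.filter fun v => A.output (A.stateAfter N T v) = some true

/-- CONGEST bandwidth: on every `n`-node network whose identifiers and weights have `O(log n)` bits
with constant `c`, every message ever sent has at most `B * log n` bits. -/
def IsCongest (A : Algorithm) (c : ℕ) (B : ℝ) : Prop :=
  ∀ (V : Type) [Fintype V] (N : Network V), N.HasLogBits c →
    ∀ (t : ℕ) (v : V) (p : ℕ), p < N.degree v →
      ((A.message (A.stateAfter N t v) p).length : ℝ) ≤ B * Real.logb 2 (Fintype.card V)

end Algorithm

end Congest

open Finset

namespace Congest


/-! Fix a constant M depending on τ. Arboricity α makes the average degree inside every vertex set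
at most 2α, so repeatedly peeling off nodes with at most D surviving neighbours (D = 4α, or 2α when
α < M) exhausts the graph in O(log n) rounds. The layers orient the edges: each node has at most D
out-neighbours, meaning neighbours in the same or a higher layer.

A thinning imitates sampling the nodes with probability ρ and then dropping those with too many
sampled out-neighbours. It keeps a ρ/2 fraction of the weight (`run_thinning`). With ρ = 1/(3M) it
divides the out-degree by M at the cost of a factor 6M in weight. After k = ⌊log_M α⌋ thinnings the
out-degree d = D/M^k is below a constant, and one more with ρ = 1/(2d) leaves an independent set.
The total loss (6M)^k · 4d = 4D · 6^k is at most α^(1+τ) for large M; it is measured against the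
total weight, which bounds OPT.

Sampling is derandomised by conditional expectations on a quadratic potential
(`potential_le_of_gain`), colour class by colour class. Mapping identifiers to code words of length
O(log n) over a constant alphabet gives, in one round, a colouring with O(log n) colours in which
few out-neighbours share a node's colour (`exists_code`, `card_same_color_le`). These few conflicts
go unpenalised, so each thinning takes O(log n) rounds. -/

/-! ### Forests, arboricity and peeling -/

open Classical in
theorem sum_degree_le_of_isAcyclic {W : Type} [Fintype W] {F : SimpleGraph W} (hF : F.IsAcyclic) :
    ∑ v, F.degree v ≤ 2 * Fintype.card W := by
  rcases isEmpty_or_nonempty W with hW | hW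
  · simp
  -- A forest extends to a spanning tree of the complete graph, whose edge count is known.
  obtain ⟨T, hFT, -, hT, hr⟩ :=
    SimpleGraph.exists_isAcyclic_reachable_eq_le_of_le_of_isAcyclic (le_top : F ≤ ⊤) hF
  have htree : T.IsTree := by
    refine ⟨⟨fun u v => ?_⟩, hT⟩
    rw [hr]
    exact SimpleGraph.connected_top.preconnected u v
  have h1 := htree.card_edgeFinset
  have h2 : #F.edgeFinset ≤ #T.edgeFinset :=
    Finset.card_le_card (SimpleGraph.edgeFinset_mono hFT)
  rw [F.sum_degrees_eq_twice_card_edges]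
  omega

open Classical in
theorem sum_card_adj_le_of_isAcyclic {V : Type} {F : SimpleGraph V} (hF : F.IsAcyclic)
    (S : Finset V) : ∑ v ∈ S, #{u ∈ S | F.Adj v u} ≤ 2 * #S := by
  have h := sum_degree_le_of_isAcyclic (hF.induce (S : Set V))
  have hcard : Fintype.card (S : Set V) = #S := by simp
  rw [hcard] at h
  rw [← Finset.sum_coe_sort]
  refine le_trans (le_of_eq (Finset.sum_congr rfl fun v _ => ?_)) h
  rw [← SimpleGraph.card_neighborFinset_eq_degree]
  refine (Finset.card_bij (fun u _ => u.1) ?_ ?_ ?_).symm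
  · intro u hu
    simpa using hu
  · intro a _ b _ hab
    exact Subtype.ext hab
  · intro u hu
    rw [Finset.mem_filter] at hu
    exact ⟨⟨u, hu.1⟩, by simpa using hu.2, rfl⟩

open Classical in
theorem HasForestPartition.sum_card_adj_le {V : Type} {G : SimpleGraph V} {k : ℕ}
    (h : HasForestPartition G k) (S : Finset V) :
    ∑ v ∈ S, #{u ∈ S | G.Adj v u} ≤ 2 * k * #S := by
  obtain ⟨F, hF, -, hU⟩ := h
  have hsub : ∀ v, #{u ∈ S | G.Adj v u} ≤ ∑ i, #{u ∈ S | (F i).Adj v u} := by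
    intro v
    refine le_trans (Finset.card_le_card ?_) Finset.card_biUnion_le
    intro u hu
    rw [Finset.mem_filter] at hu
    have he : s(v, u) ∈ ⋃ i, (F i).edgeSet := by
      rw [hU]
      exact hu.2
    obtain ⟨i, hi⟩ := Set.mem_iUnion.1 he
    exact Finset.mem_biUnion.2 ⟨i, Finset.mem_univ i, Finset.mem_filter.2 ⟨hu.1, hi⟩⟩
  calc ∑ v ∈ S, #{u ∈ S | G.Adj v u}
      ≤ ∑ v ∈ S, ∑ i, #{u ∈ S | (F i).Adj v u} := Finset.sum_le_sum fun v _ => hsub v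
    _ = ∑ i, ∑ v ∈ S, #{u ∈ S | (F i).Adj v u} := Finset.sum_comm
    _ ≤ ∑ _i : Fin k, 2 * #S :=
        Finset.sum_le_sum fun i _ => sum_card_adj_le_of_isAcyclic (hF i) S
    _ = 2 * k * #S := by
        rw [Finset.sum_const, Finset.card_univ, Fintype.card_fin, smul_eq_mul]
        ring

theorem hasForestPartition_arboricity {V : Type} {G : SimpleGraph V} (h : 0 < arboricity G) :
    HasForestPartition G (arboricity G) :=
  (Nat.sInf_mem (Nat.nonempty_of_pos_sInf h)).2

/-- Supplies n ≥ 2, hence log n ≥ 1, which the round bound needs to absorb additive constants. -/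
theorem one_lt_card_of_one_lt_arboricity {V : Type} [Fintype V] {G : SimpleGraph V}
    (h : 1 < arboricity G) : 1 < Fintype.card V := by
  by_contra hn
  have hs : Subsingleton V := Fintype.card_le_one_iff_subsingleton.1 (not_lt.1 hn)
  have : arboricity G ≤ 1 := Nat.sInf_le ⟨one_pos, fun _ => G,
    fun _ => SimpleGraph.IsAcyclic.of_subsingleton,
    fun i j hij => (hij (Subsingleton.elim i j)).elim, Set.iUnion_const _⟩
  omega

open Classical in
/-- The nodes that survive `i` rounds of peeling off all nodes with at most `d` surviving
neighbours. -/
noncomputable def survivors {V : Type} [Fintype V] (G : SimpleGraph V) (d : ℕ) : ℕ → Finset V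
  | 0 => Finset.univ
  | i + 1 => {v ∈ survivors G d i | d < #{u ∈ survivors G d i | G.Adj v u}}

-- Each node surviving the round contributes at least d + 1 to the degree sum inside the previous
-- survivors, and that sum is bounded by the forest partition.
open Classical in
theorem card_survivors_succ_le {V : Type} [Fintype V] {G : SimpleGraph V} {k : ℕ}
    (h : HasForestPartition G k) (d i : ℕ) :
    (d + 1) * #(survivors G d (i + 1)) ≤ 2 * k * #(survivors G d i) := by
  refine le_trans ?_ (h.sum_card_adj_le (survivors G d i))
  rw [mul_comm, ← smul_eq_mul]
  refine le_trans (Finset.card_nsmul_le_sum (survivors G d (i + 1))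
    (fun v => #{u ∈ survivors G d i | G.Adj v u}) (d + 1) fun v hv => ?_) ?_
  · exact (Finset.mem_filter.1 hv).2
  · exact Finset.sum_le_sum_of_subset (Finset.filter_subset _ _)

theorem card_survivors_le {V : Type} [Fintype V] {G : SimpleGraph V} {k : ℕ}
    (h : HasForestPartition G k) (d i : ℕ) :
    (#(survivors G d i) : ℝ) ≤ (2 * k / (d + 1)) ^ i * Fintype.card V := by
  induction i with
  | zero => simp [survivors]
  | succ i ih =>
    have h1 : ((d : ℝ) + 1) * #(survivors G d (i + 1)) ≤ 2 * k * #(survivors G d i) := by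
      exact_mod_cast card_survivors_succ_le h d i
    have hd : (0 : ℝ) < d + 1 := by positivity
    calc (#(survivors G d (i + 1)) : ℝ) ≤ 2 * k / (d + 1) * #(survivors G d i) := by
          rw [div_mul_eq_mul_div, le_div_iff₀ hd]
          linarith
      _ ≤ 2 * k / (d + 1) * ((2 * k / (d + 1)) ^ i * Fintype.card V) := by gcongr
      _ = _ := by ring

/-- Every block of b rounds halves the survivors, so after ⌊log₂ n⌋ + 1 blocks fewer than one is
left. -/
theorem survivors_eq_empty {V : Type} [Fintype V] {G : SimpleGraph V} {k : ℕ}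
    (h : HasForestPartition G k) {d b : ℕ} (hb : (2 * k / (d + 1) : ℝ) ^ b ≤ 1 / 2) :
    survivors G d (b * (Nat.log 2 (Fintype.card V) + 1)) = ∅ := by
  have h1 := card_survivors_le h d (b * (Nat.log 2 (Fintype.card V) + 1))
  rw [pow_mul] at h1
  have h2 : ((2 * k / (d + 1) : ℝ) ^ b) ^ (Nat.log 2 (Fintype.card V) + 1) ≤
      (1 / 2) ^ (Nat.log 2 (Fintype.card V) + 1) := by gcongr
  have h3 : (Fintype.card V : ℝ) < 2 ^ (Nat.log 2 (Fintype.card V) + 1) := by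
    exact_mod_cast Nat.lt_pow_succ_log_self one_lt_two _
  have h4 : (#(survivors G d (b * (Nat.log 2 (Fintype.card V) + 1))) : ℝ) < 1 := by
    refine lt_of_le_of_lt (h1.trans (mul_le_mul_of_nonneg_right h2 (Nat.cast_nonneg _))) ?_
    rw [one_div, inv_pow, inv_mul_lt_iff₀ (by positivity)]
    simpa using h3
  exact Finset.card_eq_zero.1 (Nat.lt_one_iff.1 (by exact_mod_cast h4))


/-! ### A code with few agreements -/

/-- The words that agree with a given word at many positions are few. -/
theorem card_agreeing_words_le (r m : ℕ) (x : Fin m → Fin (4 ^ r)) :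
    4 ^ m * #{y : Fin m → Fin (4 ^ r) | m < #{i | y i = x i} * r} ≤ 2 ^ m * (4 ^ r) ^ m := by
  -- Union bound over the at most 2^m agreement sets S with #S * r > m; prescribing the letters on S
  -- leaves at most a 4^(-m) fraction of all words.
  have hsub : ({y : Fin m → Fin (4 ^ r) | m < #{i | y i = x i} * r} : Finset _) ⊆
      ({S : Finset (Fin m) | m < #S * r} : Finset _).biUnion
        fun S => {y : Fin m → Fin (4 ^ r) | ∀ i ∈ S, y i = x i} := by
    intro y hy
    rw [Finset.mem_filter] at hy
    refine Finset.mem_biUnion.2 ⟨({i | y i = x i} : Finset _), ?_, ?_⟩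
    · exact Finset.mem_filter.2 ⟨Finset.mem_univ _, hy.2⟩
    · simp
  have hcard : ∀ S : Finset (Fin m), m < #S * r →
      4 ^ m * #{y : Fin m → Fin (4 ^ r) | ∀ i ∈ S, y i = x i} ≤ (4 ^ r) ^ m := by
    intro S hS
    have h1 : #{y : Fin m → Fin (4 ^ r) | ∀ i ∈ S, y i = x i} = (4 ^ r) ^ (m - #S) := by
      have : ({y : Fin m → Fin (4 ^ r) | ∀ i ∈ S, y i = x i} : Finset _) =
          Fintype.piFinset fun i => if i ∈ S then {x i} else Finset.univ := by
        ext y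
        simp only [Finset.mem_filter, Finset.mem_univ, true_and, Fintype.mem_piFinset]
        refine forall_congr' fun i => ?_
        by_cases hi : i ∈ S <;> simp [hi]
      rw [this, Fintype.card_piFinset]
      have h2 : ∀ i, #(if i ∈ S then {x i} else (Finset.univ : Finset (Fin (4 ^ r)))) =
          if i ∈ S then 1 else 4 ^ r := by
        intro i
        by_cases hi : i ∈ S <;> simp [hi]
      rw [Finset.prod_congr rfl fun i _ => h2 i, Finset.prod_ite]
      simp only [Finset.prod_const, one_pow, one_mul]
      congr 1
      rw [Finset.filter_not, Finset.filter_mem_eq_inter, Finset.univ_inter,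
        Finset.card_sdiff_of_subset (Finset.subset_univ S), Finset.card_univ, Fintype.card_fin]
    have hSm : #S ≤ m := by simpa using Finset.card_le_univ S
    calc 4 ^ m * #{y : Fin m → Fin (4 ^ r) | ∀ i ∈ S, y i = x i}
        ≤ (4 ^ r) ^ #S * (4 ^ r) ^ (m - #S) := by
          rw [h1, ← pow_mul 4 r #S]
          gcongr
          · norm_num
          · rw [mul_comm]
            exact hS.le
      _ = (4 ^ r) ^ m := by rw [← pow_add, Nat.add_sub_cancel' hSm]
  calc 4 ^ m * #{y : Fin m → Fin (4 ^ r) | m < #{i | y i = x i} * r}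
      ≤ 4 ^ m * ∑ S ∈ ({S : Finset (Fin m) | m < #S * r} : Finset _),
          #{y : Fin m → Fin (4 ^ r) | ∀ i ∈ S, y i = x i} :=
        Nat.mul_le_mul_left _ ((Finset.card_le_card hsub).trans Finset.card_biUnion_le)
    _ = ∑ S ∈ ({S : Finset (Fin m) | m < #S * r} : Finset _),
          4 ^ m * #{y : Fin m → Fin (4 ^ r) | ∀ i ∈ S, y i = x i} := Finset.mul_sum _ _ _
    _ ≤ #({S : Finset (Fin m) | m < #S * r} : Finset _) • (4 ^ r) ^ m :=
        Finset.sum_le_card_nsmul _ _ _ fun S hS => hcard S (Finset.mem_filter.1 hS).2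
    _ ≤ 2 ^ m * (4 ^ r) ^ m := by
        rw [smul_eq_mul]
        refine Nat.mul_le_mul_right _ ((Finset.card_filter_le _ _).trans ?_)
        simp

/-- There are `2 ^ m` words of length `m` over an alphabet with `4 ^ r` letters, any two of which
agree at no more than `m / r` positions. -/
theorem exists_code (r m : ℕ) :
    ∃ f : ℕ → Fin m → Fin (4 ^ r), ∀ a < 2 ^ m, ∀ b < 2 ^ m, a ≠ b →
      #{i | f a i = f b i} * r ≤ m := by
  -- Greedy (Gilbert–Varshamov) choice: each earlier word forbids at most a 2^(-m) fraction of all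
  -- words, so fewer than 2^m earlier words leave a free one.
  suffices h : ∀ s ≤ 2 ^ m, ∃ f : ℕ → Fin m → Fin (4 ^ r), ∀ a < s, ∀ b < a,
      #{i | f a i = f b i} * r ≤ m by
    obtain ⟨f, hf⟩ := h _ le_rfl
    refine ⟨f, fun a ha b hb hab => ?_⟩
    rcases lt_or_gt_of_ne hab with h | h
    · have := hf b hb a h
      simpa only [eq_comm] using this
    · exact hf a ha b h
  intro s
  induction s with
  | zero => exact fun _ => ⟨fun _ _ => ⟨0, by positivity⟩, by simp⟩
  | succ s ih =>
    intro hs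
    obtain ⟨f, hf⟩ := ih (by omega)
    have hy : ∃ y : Fin m → Fin (4 ^ r), ∀ b < s, #{i | y i = f b i} * r ≤ m := by
      by_contra! hcon
      have hcover : (Finset.univ : Finset (Fin m → Fin (4 ^ r))) ⊆
          (Finset.range s).biUnion fun b => {y | m < #{i | y i = f b i} * r} := by
        intro y _
        obtain ⟨b, hb, hlt⟩ := hcon y
        exact Finset.mem_biUnion.2 ⟨b, Finset.mem_range.2 hb,
          Finset.mem_filter.2 ⟨Finset.mem_univ _, hlt⟩⟩
      have h1 : (4 ^ r) ^ m ≤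
          ∑ b ∈ Finset.range s, #{y : Fin m → Fin (4 ^ r) | m < #{i | y i = f b i} * r} := by
        have := (Finset.card_le_card hcover).trans Finset.card_biUnion_le
        simpa using this
      have h2 : 4 ^ m * (4 ^ r) ^ m ≤ s * (2 ^ m * (4 ^ r) ^ m) := by
        calc 4 ^ m * (4 ^ r) ^ m
            ≤ 4 ^ m * ∑ b ∈ Finset.range s,
                #{y : Fin m → Fin (4 ^ r) | m < #{i | y i = f b i} * r} :=
              Nat.mul_le_mul_left _ h1
          _ = ∑ b ∈ Finset.range s,
                4 ^ m * #{y : Fin m → Fin (4 ^ r) | m < #{i | y i = f b i} * r} :=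
              Finset.mul_sum _ _ _
          _ ≤ #(Finset.range s) • (2 ^ m * (4 ^ r) ^ m) :=
              Finset.sum_le_card_nsmul _ _ _ fun b _ => card_agreeing_words_le r m (f b)
          _ = _ := by rw [Finset.card_range, smul_eq_mul]
      have h3 : (4 : ℕ) ^ m = 2 ^ m * 2 ^ m := by rw [← mul_pow]; norm_num
      rw [h3, ← mul_assoc] at h2
      have h4 : 2 ^ m * 2 ^ m ≤ s * 2 ^ m := Nat.le_of_mul_le_mul_right h2 (by positivity)
      have h5 : 2 ^ m ≤ s := Nat.le_of_mul_le_mul_right h4 (by positivity)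
      omega
    obtain ⟨y, hy⟩ := hy
    refine ⟨fun a => if a = s then y else f a, fun a ha b hb => ?_⟩
    have hbs : b ≠ s := by omega
    by_cases has : a = s
    · simp only [has, hbs, if_true, if_false]
      exact hy b (by omega)
    · simp only [has, hbs, if_false]
      exact hf a (by omega) b hb


/-! ### Broadcast programs as CONGEST algorithms -/

/-- One round of a broadcast program: a node computes its new public state from its own public
state and those of its neighbours. -/
abbrev LocalStep (P : Type) : Type := P → Multiset P → P

open Classical in
/-- The public states of the neighbours of `v`. -/
noncomputable def nbrStates {V P : Type} [Fintype V] (G : SimpleGraph V) (s : V → P) (v : V) :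
    Multiset P :=
  (Finset.univ.filter (G.Adj v)).val.map s

noncomputable def runStep {V P : Type} [Fintype V] (G : SimpleGraph V) (f : LocalStep P)
    (s : V → P) : V → P :=
  fun v => f (s v) (nbrStates G s v)

noncomputable def run {V P : Type} [Fintype V] (G : SimpleGraph V) (l : List (LocalStep P))
    (s : V → P) : V → P :=
  l.foldl (fun s f => runStep G f s) s

section Run

variable {V P : Type} [Fintype V] (G : SimpleGraph V)

theorem countP_nbrStates (s : V → P) (v : V) (q : P → Prop) [DecidablePred q]
    [DecidablePred fun u => G.Adj v u ∧ q (s u)] :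
    (nbrStates G s v).countP q = #{u | G.Adj v u ∧ q (s u)} := by
  classical
  rw [nbrStates, Multiset.countP_map, ← Finset.filter_val, Finset.card_val, Finset.filter_filter]
  congr

open Classical in
theorem sum_map_nbrStates (s : V → P) (v : V) (g : P → ℝ) :
    ((nbrStates G s v).map g).sum = ∑ u, if G.Adj v u then g (s u) else 0 := by
  rw [nbrStates, Multiset.map_map, ← Finset.sum_filter]
  rfl

@[simp]
theorem run_nil (s : V → P) : run G [] s = s := rfl

@[simp]
theorem run_cons (f : LocalStep P) (l : List (LocalStep P)) (s : V → P) :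
    run G (f :: l) s = run G l (runStep G f s) := rfl

theorem run_append (l l' : List (LocalStep P)) (s : V → P) :
    run G (l ++ l') s = run G l' (run G l s) :=
  List.foldl_append

theorem run_range_succ (f : ℕ → LocalStep P) (t : ℕ) (s : V → P) :
    run G ((List.range (t + 1)).map f) s =
      runStep G (f t) (run G ((List.range t).map f) s) := by
  rw [List.range_succ, List.map_append, run_append]
  rfl

theorem run_take_succ {l : List (LocalStep P)} {t : ℕ} (h : t < l.length) (s : V → P) :
    run G (l.take (t + 1)) s = runStep G l[t] (run G (l.take t) s) := by
  rw [List.take_succ_eq_append_getElem h, run_append]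
  rfl

theorem run_induction {l : List (LocalStep P)} {valid : P → Prop}
    (hl : ∀ f ∈ l, ∀ p M, valid p → valid (f p M)) {s : V → P} (hs : ∀ v, valid (s v)) (v : V) :
    valid (run G l s v) := by
  induction l generalizing s with
  | nil => exact hs v
  | cons f l ih =>
    rw [run_cons]
    exact ih (fun g hg => hl g (List.mem_cons_of_mem f hg))
      fun v => hl f List.mem_cons_self _ _ (hs v)

end Run

/-- The ports of a node enumerate its neighbours bijectively, so the multiset of decoded messages
does not depend on the port numbering. -/
theorem Network.map_range_inbox {V P : Type} [Fintype V] (N : Network V) (s : V → P)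
    (g : V → List Bool) (dec : List Bool → P) (h : ∀ v, dec (g v) = s v) (v : V) :
    (Multiset.range (N.degree v)).map (fun p => dec (N.inbox (fun u _ => g u) v p)) =
      nbrStates N.graph s v := by
  classical
  have h1 : (Multiset.range (N.degree v)).map (fun p => dec (N.inbox (fun u _ => g u) v p)) =
      (Finset.univ : Finset (Fin (N.degree v))).val.map fun i => s (N.port v i) := by
    have : Multiset.range (N.degree v) =
        (Finset.univ : Finset (Fin (N.degree v))).val.map Fin.val := by
      rw [← Finset.range_val, ← Finset.image_val_of_injOn Fin.val_injective.injOn]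
      congr 1
      ext i
      simp only [Finset.mem_range, Finset.mem_image, Finset.mem_univ, true_and]
      exact ⟨fun hi => ⟨⟨i, hi⟩, rfl⟩, by rintro ⟨j, rfl⟩; exact j.2⟩
    rw [this, Multiset.map_map]
    refine Multiset.map_congr rfl fun i _ => ?_
    have hi : (i : ℕ) < (N.graph.neighborSet v).ncard := i.2
    simp only [Function.comp, Network.inbox, hi, dif_pos]
    exact h _
  rw [h1, nbrStates]
  have h2 : (Finset.univ.filter (N.graph.Adj v)) =
      Finset.univ.image fun i : Fin (N.degree v) => (N.port v i : V) := by
    ext u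
    simp only [Finset.mem_filter, Finset.mem_univ, true_and, Finset.mem_image]
    constructor
    · intro hu
      exact ⟨(N.port v).symm ⟨u, hu⟩, by simp⟩
    · rintro ⟨i, rfl⟩
      exact (N.port v i).2
  rw [h2, Finset.image_val_of_injOn, Multiset.map_map]
  · rfl
  · intro i _ j _ hij
    exact (N.port v).injective (Subtype.ext hij)

/-- The algorithm in which all nodes run the program for `n` and `α`, broadcasting their public
states in every round, and halt at its end. -/
noncomputable def broadcast {P : Type} [Nonempty P] (prog : ℕ → ℕ → List (LocalStep P))
    (init : LocalInput → P) (enc : P → List Bool) (lim : ℕ → ℕ) (out : P → Bool) : Algorithm where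
  State := LocalInput × ℕ × P
  init i := (i, 0, init i)
  -- Falling silent above the limit makes the bandwidth bound hold by construction; correctness then
  -- requires that the limit is never exceeded.
  send s _ := if (enc s.2.2).length ≤ lim s.1.numNodes then enc s.2.2 else []
  step s inbox := (s.1, s.2.1 + 1,
    if h : s.2.1 < (prog s.1.numNodes s.1.arboricity).length then
      (prog s.1.numNodes s.1.arboricity)[s.2.1] s.2.2
        ((Multiset.range s.1.degree).map fun p => Function.invFun enc (inbox p))
    else s.2.2)
  output s :=
    if (prog s.1.numNodes s.1.arboricity).length ≤ s.2.1 then some (out s.2.2) else none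

noncomputable def Network.input {V : Type} [Fintype V] (N : Network V) (v : V) : LocalInput where
  numNodes := Fintype.card V
  arboricity := Congest.arboricity N.graph
  ident := N.ident v
  weight := N.weight v
  degree := N.degree v

theorem Algorithm.stateAfter_succ {V : Type} [Fintype V] (A : Algorithm) (N : Network V) (t : ℕ)
    (v : V) : A.stateAfter N (t + 1) v =
      if (A.output (A.stateAfter N t v)).isSome then A.stateAfter N t v
      else A.step (A.stateAfter N t v)
        (N.inbox (fun u p => A.message (A.stateAfter N t u) p) v) :=
  rfl

section Broadcast

variable {P : Type} [Nonempty P] {prog : ℕ → ℕ → List (LocalStep P)} {init : LocalInput → P}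
  {enc : P → List Bool} {lim : ℕ → ℕ} {out : P → Bool} {V : Type} [Fintype V] (N : Network V)

theorem broadcast_stateAfter_fst (t : ℕ) (v : V) :
    ((broadcast prog init enc lim out).stateAfter N t v).1 = N.input v := by
  induction t with
  | zero => rfl
  | succ t ih =>
    rw [Algorithm.stateAfter_succ]
    split_ifs
    · exact ih
    · exact ih

theorem broadcast_isCongest (c : ℕ) {B : ℝ}
    (hB : ∀ n : ℕ, 2 ≤ n → (lim n : ℝ) ≤ B * Real.logb 2 n) :
    (broadcast prog init enc lim out).IsCongest c B := by
  intro V _ N _ t v p hp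
  have hn : 2 ≤ Fintype.card V := by
    have hpos : 0 < (N.graph.neighborSet v).ncard := by
      unfold Network.degree at hp
      omega
    obtain ⟨u, hu⟩ := (Set.ncard_pos (Set.toFinite _)).1 hpos
    exact Fintype.one_lt_card_iff.2 ⟨v, u, N.graph.ne_of_adj hu⟩
  refine le_trans ?_ (hB _ hn)
  have h1 : (((broadcast prog init enc lim out).stateAfter N t v).1).numNodes =
      Fintype.card V := by
    rw [broadcast_stateAfter_fst]
    rfl
  rw [Nat.cast_le, Algorithm.message]
  split_ifs
  · simp
  · simp only [broadcast]
    split_ifs with h2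
    · rw [← h1]
      exact h2
    · simp

/-- All nodes reach the end of the program simultaneously, so no message is lost to early halting,
and `hlim` excludes loss to the length limit. -/
theorem broadcast_stateAfter (henc : Function.Injective enc)
    (hlim : ∀ t v, (enc (run N.graph
      ((prog (Fintype.card V) (arboricity N.graph)).take t) (fun v => init (N.input v)) v)).length ≤
        lim (Fintype.card V))
    (t : ℕ) (ht : t ≤ (prog (Fintype.card V) (arboricity N.graph)).length) (v : V) :
    (broadcast prog init enc lim out).stateAfter N t v =
      (N.input v, t, run N.graph ((prog (Fintype.card V) (arboricity N.graph)).take t)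
        (fun v => init (N.input v)) v) := by
  induction t generalizing v with
  | zero => rfl
  | succ t ih =>
    have ht' : t < (prog (Fintype.card V) (arboricity N.graph)).length := ht
    have ih' := fun v => ih ht'.le v
    have hout : ∀ v, (broadcast prog init enc lim out).output
        ((broadcast prog init enc lim out).stateAfter N t v) = none := by
      intro v
      rw [ih' v]
      simp only [broadcast, Network.input]
      rw [if_neg (by omega)]
    have hmsg : (fun u p => (broadcast prog init enc lim out).message
        ((broadcast prog init enc lim out).stateAfter N t u) p) =
        fun u _ => enc (run N.graph ((prog (Fintype.card V) (arboricity N.graph)).take t)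
          (fun v => init (N.input v)) u) := by
      funext u p
      rw [Algorithm.message, hout u, if_neg (by simp), ih' u]
      exact if_pos (hlim t u)
    rw [Algorithm.stateAfter_succ, hout v, if_neg (by simp), hmsg, ih' v,
      run_take_succ N.graph ht']
    refine congrArg (fun z => (N.input v, t + 1, z)) ?_
    rw [dif_pos (by exact ht')]
    refine congrArg _ ?_
    exact N.map_range_inbox _ _ (Function.invFun enc)
      (fun v => Function.leftInverse_invFun henc _) v

theorem broadcast_haltsWithin (henc : Function.Injective enc)
    (hlim : ∀ t v, (enc (run N.graph
      ((prog (Fintype.card V) (arboricity N.graph)).take t) (fun v => init (N.input v)) v)).length ≤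
        lim (Fintype.card V)) :
    (broadcast prog init enc lim out).HaltsWithin N
      (prog (Fintype.card V) (arboricity N.graph)).length := by
  intro v
  rw [broadcast_stateAfter N henc hlim _ le_rfl]
  simp [broadcast, Network.input]

theorem mem_broadcast_outputSet (henc : Function.Injective enc)
    (hlim : ∀ t v, (enc (run N.graph
      ((prog (Fintype.card V) (arboricity N.graph)).take t) (fun v => init (N.input v)) v)).length ≤
        lim (Fintype.card V)) (v : V) :
    v ∈ (broadcast prog init enc lim out).outputSet N
        (prog (Fintype.card V) (arboricity N.graph)).length ↔
      out (run N.graph (prog (Fintype.card V) (arboricity N.graph))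
        (fun v => init (N.input v)) v) = true := by
  rw [Algorithm.outputSet, Finset.mem_filter, broadcast_stateAfter N henc hlim _ le_rfl]
  simp [broadcast, Network.input]

end Broadcast


/-! ### Derandomised thinning -/

section Potential

variable {V : Type} [Fintype V] (w : V → ℝ) (b : V → V → ℝ)

/-- The weight of the fractional set `x`, minus a penalty `b v u` for every conflict. -/
def potential (x : V → ℝ) : ℝ := ∑ v, w v * x v - ∑ v, ∑ u, b v u * x v * x u

/-- The potential is quadratic. Expanding it at x, the second-order term vanishes because `b` is
zero on S × S and y − x is zero off S. Only the first-order gains remain, so all nodes of S may move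
at once. -/
theorem potential_le_of_gain {x y : V → ℝ} (S : Finset V) (hS : ∀ v, v ∉ S → y v = x v)
    (hb : ∀ v ∈ S, ∀ u ∈ S, b v u = 0)
    (hgain : ∀ v ∈ S, 0 ≤ (y v - x v) * (w v - ∑ u, (b v u + b u v) * x u)) :
    potential w b x ≤ potential w b y := by
  have hzero : ∑ v, ∑ u, b v u * (y v - x v) * (y u - x u) = 0 := by
    refine Finset.sum_eq_zero fun v _ => Finset.sum_eq_zero fun u _ => ?_
    by_cases hv : v ∈ S
    · by_cases hu : u ∈ S
      · rw [hb v hv u hu, zero_mul, zero_mul]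
      · rw [hS u hu, sub_self, mul_zero]
    · rw [hS v hv, sub_self, mul_zero, zero_mul]
  have hcomm : ∑ v, ∑ u, b v u * x v * (y u - x u) = ∑ v, ∑ u, b u v * x u * (y v - x v) :=
    Finset.sum_comm
  have hsum : 0 ≤ ∑ v, (y v - x v) * (w v - ∑ u, (b v u + b u v) * x u) := by
    refine Finset.sum_nonneg fun v _ => ?_
    by_cases hv : v ∈ S
    · exact hgain v hv
    · rw [hS v hv, sub_self, zero_mul]
  have hexp : potential w b y = potential w b x +
      ∑ v, (y v - x v) * (w v - ∑ u, (b v u + b u v) * x u) -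
      ∑ v, ∑ u, b v u * (y v - x v) * (y u - x u) := by
    have h1 : ∑ v, (y v - x v) * (w v - ∑ u, (b v u + b u v) * x u) =
        ∑ v, (y v - x v) * w v - (∑ v, ∑ u, b v u * (y v - x v) * x u +
          ∑ v, ∑ u, b u v * x u * (y v - x v)) := by
      rw [← Finset.sum_add_distrib, ← Finset.sum_sub_distrib]
      refine Finset.sum_congr rfl fun v _ => ?_
      rw [mul_sub, Finset.mul_sum, ← Finset.sum_add_distrib]
      refine congrArg _ (Finset.sum_congr rfl fun u _ => ?_)
      ring
    rw [h1, ← hcomm, potential, potential]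
    have h2 : ∀ v u, b v u * y v * y u = b v u * x v * x u + (b v u * (y v - x v) * x u +
        b v u * x v * (y u - x u)) + b v u * (y v - x v) * (y u - x u) := fun v u => by ring
    have h3 : ∀ v, w v * y v = w v * x v + (y v - x v) * w v := fun v => by ring
    simp only [h2, h3, Finset.sum_add_distrib]
    ring
  rw [hexp, hzero]
  linarith

end Potential

/-- What a node broadcasts in every round. -/
structure Pub where
  ident : ℕ
  weight : ℚ≥0
  layer : ℕ
  color : ℕ
  alive : Bool
  choice : Option Bool

instance : Nonempty Pub := ⟨⟨0, 0, 0, 0, true, none⟩⟩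

namespace Pub

/-- The fractional value of a node, `ρ` as long as it is undecided. -/
noncomputable def val (ρ : ℝ) (a : Pub) : ℝ :=
  if a.alive then a.choice.elim ρ fun b => if b then 1 else 0 else 0

/-- The penalty that `a` pays if its neighbour `b` is chosen together with it. -/
noncomputable def penalty (lam : ℝ) (a b : Pub) : ℝ :=
  if a.layer ≤ b.layer ∧ a.color ≠ b.color then lam * a.weight else 0

end Pub

open Classical in
/-- A node picks a position of its code word at which few of its living out-neighbours have the
same letter, and is coloured by that position and that letter. -/
noncomputable def colorStep {r m : ℕ} (code : ℕ → Fin m → Fin (4 ^ r)) (d : ℝ) :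
    LocalStep Pub := fun a M =>
  { a with
    choice := none
    color :=
      if h : ∃ i, (M.countP (fun b => b.alive ∧ a.layer ≤ b.layer ∧
          code b.ident i = code a.ident i) * r : ℝ) ≤ d then
        (finProdFinEquiv (h.choose, code a.ident h.choose)).val
      -- Never reached by a node of out-degree at most d, by `exists_position`.
      else 0 }

/-- The nodes of colour `t` decide, each maximising the potential. -/
noncomputable def decideStep (lam ρ : ℝ) (t : ℕ) : LocalStep Pub := fun a M =>
  if a.color = t then
    { a with
      choice := some (decide
        ((M.map fun b => (a.penalty lam b + b.penalty lam a) * b.val ρ).sum ≤ (a.weight : ℝ))) }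
  else a

open Classical in
/-- The chosen nodes survive, except those with too many chosen out-neighbours. -/
noncomputable def dropStep (lam : ℝ) : LocalStep Pub := fun a M =>
  { a with
    alive := a.alive && decide (a.choice = some true) &&
      decide (lam * M.countP (fun b => b.alive ∧ b.choice = some true ∧ a.layer ≤ b.layer ∧
        a.color ≠ b.color) < 1) }

/-- Thin out the living nodes, whose out-degree is at most `d`, by sampling with probability `ρ`,
derandomised. -/
noncomputable def thinning {r m : ℕ} (code : ℕ → Fin m → Fin (4 ^ r)) (d ρ : ℝ) :
    List (LocalStep Pub) :=
  colorStep code d ::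
    -- Under sampling at most dρ chosen out-neighbours are expected, so with this penalty factor the
    -- expected penalty is at most half the expected weight, while 2dρ penalised conflicts cancel a
    -- node's whole weight.
    ((List.range (m * 4 ^ r)).map (decideStep (1 / (2 * d * ρ)) ρ) ++
      [dropStep (1 / (2 * d * ρ))])

section Thinning

variable {V : Type} [Fintype V] (G : SimpleGraph V)

/-- The number of living neighbours in the same or a higher layer. -/
noncomputable def outDegree (s : V → Pub) (v : V) : ℕ :=
  (nbrStates G s v).countP fun b => b.alive ∧ (s v).layer ≤ b.layer

/-- The living nodes. -/
def living (s : V → Pub) : Finset V := {v | (s v).alive}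

/-- The total weight of the living nodes. -/
noncomputable def livingWeight (s : V → Pub) : ℝ := ∑ v ∈ living s, ((s v).weight : ℝ)

variable {r m : ℕ} {code : ℕ → Fin m → Fin (4 ^ r)} {d ρ lam : ℝ}

theorem color_colorStep_lt (hm : 0 < m) (a : Pub) (M : Multiset Pub) :
    (colorStep code d a M).color < m * 4 ^ r := by
  simp only [colorStep]
  split_ifs
  · exact Fin.isLt _
  · positivity

-- Averaging over positions: each of the at most d out-neighbours agrees with v at no more than m/r
-- of the m positions.
open Classical in
theorem exists_position {s : V → Pub} (hm : 0 < m)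
    (hcode : ∀ u v, G.Adj v u →
      #{i | code (s u).ident i = code (s v).ident i} * r ≤ m)
    {v : V} (hd : (outDegree G s v : ℝ) ≤ d) :
    ∃ i, ((nbrStates G s v).countP (fun b => b.alive ∧ (s v).layer ≤ b.layer ∧
      code b.ident i = code (s v).ident i) * r : ℝ) ≤ d := by
  set O : Finset V := {u | G.Adj v u ∧ ((s u).alive = true ∧ (s v).layer ≤ (s u).layer)} with hO
  have hcount : ∀ i, (nbrStates G s v).countP (fun b => b.alive ∧ (s v).layer ≤ b.layer ∧
      code b.ident i = code (s v).ident i) =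
      #{u ∈ O | code (s u).ident i = code (s v).ident i} := by
    intro i
    rw [countP_nbrStates, hO, Finset.filter_filter]
    congr 1
    ext u
    simp only [Finset.mem_filter, Finset.mem_univ, true_and]
    tauto
  have hOd : (#O : ℝ) ≤ d := by
    rw [outDegree, countP_nbrStates] at hd
    exact hd
  by_contra! hcon
  have h1 : ∑ i : Fin m, #{u ∈ O | code (s u).ident i = code (s v).ident i} * r ≤ #O * m := by
    have h2 : ∑ i : Fin m, #{u ∈ O | code (s u).ident i = code (s v).ident i} =
        ∑ u ∈ O, #{i | code (s u).ident i = code (s v).ident i} := by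
      simp only [Finset.card_filter]
      exact Finset.sum_comm
    rw [← Finset.sum_mul, h2, Finset.sum_mul]
    refine (Finset.sum_le_card_nsmul _ _ m fun u hu => ?_).trans (le_of_eq (smul_eq_mul _ _))
    exact hcode u v (Finset.mem_filter.1 hu).2.1
  have h3 : (m : ℝ) * d <
      ∑ i : Fin m, (#{u ∈ O | code (s u).ident i = code (s v).ident i} * r : ℝ) := by
    have : (m : ℝ) * d = ∑ _i : Fin m, d := by simp
    rw [this]
    refine Finset.sum_lt_sum_of_nonempty ⟨⟨0, hm⟩, Finset.mem_univ _⟩ fun i _ => ?_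
    rw [← hcount]
    exact hcon i
  have h4 : (∑ i : Fin m, (#{u ∈ O | code (s u).ident i = code (s v).ident i} * r : ℝ)) ≤
      #O * m := by exact_mod_cast h1
  have h5 : (#O : ℝ) * m ≤ d * m := by gcongr
  linarith

-- A colour encodes both a position and a letter, so out-neighbours coloured like v share v's letter
-- at the position v picked.
open Classical in
theorem card_same_color_le {s : V → Pub} (hm : 0 < m)
    (hcode : ∀ u v, G.Adj v u →
      #{i | code (s u).ident i = code (s v).ident i} * r ≤ m)
    (hd : ∀ v, (s v).alive → (outDegree G s v : ℝ) ≤ d) {v : V} (hv : (s v).alive) :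
    (#{u | G.Adj v u ∧ (s u).alive ∧ (s v).layer ≤ (s u).layer ∧
      (runStep G (colorStep code d) s v).color = (runStep G (colorStep code d) s u).color} * r : ℝ)
      ≤ d := by
  have hex := exists_position G hm hcode (hd v hv)
  refine le_trans ?_ hex.choose_spec
  gcongr
  rw [countP_nbrStates]
  refine Finset.card_le_card fun u hu => ?_
  obtain ⟨-, hadj, hal, hlay, hcol⟩ := Finset.mem_filter.1 hu
  refine Finset.mem_filter.2 ⟨Finset.mem_univ _, hadj, hal, hlay, ?_⟩
  have hexu := exists_position G hm hcode (hd u hal)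
  simp only [runStep, colorStep] at hcol
  rw [dif_pos hex, dif_pos hexu] at hcol
  have h := finProdFinEquiv.injective (Fin.ext hcol)
  obtain ⟨h1, h2⟩ := Prod.mk.inj h
  rw [h2, ← h1]

open Classical in
/-- The conflicts that are penalised during a thinning. -/
noncomputable def conflict (lam : ℝ) (s : V → Pub) (v u : V) : ℝ :=
  if G.Adj v u then (s v).penalty lam (s u) else 0

/-- Only `choice` ever changes, so the conflicts stay those of the initial state, and the nodes of
colour t are still undecided when round t begins. -/
theorem run_decideStep (s : V → Pub) (hs : ∀ v, (s v).choice = none) (t : ℕ) (v : V) :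
    (∃ o, run G ((List.range t).map (decideStep lam ρ)) s v = { s v with choice := o }) ∧
      ((run G ((List.range t).map (decideStep lam ρ)) s v).choice = none ↔ t ≤ (s v).color) := by
  induction t with
  | zero => exact ⟨⟨none, by simp [← hs v]⟩, by simp [hs v]⟩
  | succ t ih =>
    obtain ⟨⟨o, ho⟩, hiff⟩ := ih
    rw [run_range_succ]
    simp only [runStep, decideStep]
    split_ifs with hcol
    · rw [ho] at hcol
      refine ⟨⟨_, by rw [ho]⟩, ?_⟩
      simp only [false_iff]
      simp only at hcol
      omega
    · refine ⟨⟨o, ho⟩, hiff.trans ?_⟩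
      rw [ho] at hcol
      simp only at hcol
      omega

/-- Conditional expectations: equal colours carry no mutual penalty, so the living nodes of colour t
can all move from ρ to 1 or 0 according to the sign of their first-order coefficient. -/
theorem potential_run_decideStep (hρ : 0 ≤ ρ) (hρ1 : ρ ≤ 1) (s : V → Pub)
    (hs : ∀ v, (s v).choice = none) (t : ℕ) :
    potential (fun v => (s v).weight) (conflict G lam s) (fun v => (s v).val ρ) ≤
      potential (fun v => (s v).weight) (conflict G lam s) fun v =>
        (run G ((List.range t).map (decideStep lam ρ)) s v).val ρ := by
  induction t with
  | zero => exact le_rfl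
  | succ t ih =>
    refine ih.trans ?_
    rw [run_range_succ]
    set c := run G ((List.range t).map (decideStep lam ρ)) s with hc
    have hprop := fun v => run_decideStep G (lam := lam) (ρ := ρ) s hs t v
    rw [← hc] at hprop
    have hlayer : ∀ v, (c v).layer = (s v).layer := fun v => by
      obtain ⟨⟨o, ho⟩, -⟩ := hprop v; rw [ho]
    have hcolor : ∀ v, (c v).color = (s v).color := fun v => by
      obtain ⟨⟨o, ho⟩, -⟩ := hprop v; rw [ho]
    have hweight : ∀ v, (c v).weight = (s v).weight := fun v => by
      obtain ⟨⟨o, ho⟩, -⟩ := hprop v; rw [ho]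
    refine potential_le_of_gain _ _ {v | (c v).alive ∧ (s v).color = t} ?_ ?_ ?_
    · intro v hv
      simp only [runStep, decideStep, hcolor]
      split_ifs with hcol
      · have : (c v).alive = false := by simpa [hcol] using hv
        simp [Pub.val, this]
      · rfl
    · intro v hv u hu
      have hv' := (Finset.mem_filter.1 hv).2.2
      have hu' := (Finset.mem_filter.1 hu).2.2
      simp [conflict, Pub.penalty, hv', hu']
    · intro v hv
      obtain ⟨-, hal, hcol⟩ := Finset.mem_filter.1 hv
      have hnone : (c v).choice = none := (hprop v).2.2 hcol.ge
      have hsum : ((nbrStates G c v).map fun b =>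
          ((c v).penalty lam b + b.penalty lam (c v)) * b.val ρ).sum =
          ∑ u, (conflict G lam s v u + conflict G lam s u v) * (c u).val ρ := by
        classical
        rw [sum_map_nbrStates]
        refine Finset.sum_congr rfl fun u _ => ?_
        by_cases hadj : G.Adj v u
        · simp [conflict, hadj, hadj.symm, Pub.penalty, hlayer, hcolor, hweight]
        · have : ¬ G.Adj u v := fun h => hadj h.symm
          simp [conflict, hadj, this]
      have hval : (c v).val ρ = ρ := by simp [Pub.val, hal, hnone]
      have hval' : (runStep G (decideStep lam ρ t) c v).val ρ =
          if ∑ u, (conflict G lam s v u + conflict G lam s u v) * (c u).val ρ ≤ (s v).weight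
          then 1 else 0 := by
        rw [runStep, decideStep, hcolor, if_pos hcol, hsum, hweight]
        simp [Pub.val, hal]
      rw [hval', hval]
      split_ifs with hle
      · exact mul_nonneg (by linarith) (by linarith)
      · push Not at hle
        exact mul_nonneg_of_nonpos_of_nonpos (by linarith) (by linarith)

theorem potential_eq_sum_mul (w : V → ℝ) (b : V → V → ℝ) (x : V → ℝ) :
    potential w b x = ∑ v, x v * (w v - ∑ u, b v u * x u) := by
  rw [potential, ← Finset.sum_sub_distrib]
  refine Finset.sum_congr rfl fun v _ => ?_
  rw [mul_sub, Finset.mul_sum, mul_comm]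
  refine congrArg _ (Finset.sum_congr rfl fun u _ => ?_)
  ring

open Classical in
theorem sum_conflict_mul (s : V → Pub) (v : V) (q : V → Prop) [DecidablePred q]
    (a : ℝ) :
    ∑ u, conflict G lam s v u * (if q u then a else 0) =
      lam * (s v).weight * a *
        #{u | G.Adj v u ∧ q u ∧ (s v).layer ≤ (s u).layer ∧ (s v).color ≠ (s u).color} := by
  rw [Finset.card_filter, Nat.cast_sum, Finset.mul_sum]
  refine Finset.sum_congr rfl fun u _ => ?_
  by_cases h1 : G.Adj v u <;> by_cases h2 : q u <;>
    by_cases h3 : (s v).layer ≤ (s u).layer ∧ (s v).color ≠ (s u).color <;>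
    simp [conflict, Pub.penalty, h1, h2, h3]

theorem le_potential_of_undecided (hlam : 0 ≤ lam) (hρ : 0 ≤ ρ) (s : V → Pub)
    (hs : ∀ v, (s v).choice = none) (hd : ∀ v, (s v).alive → (outDegree G s v : ℝ) ≤ d) :
    ρ * (1 - lam * d * ρ) * livingWeight s ≤
      potential (fun v => (s v).weight) (conflict G lam s) (fun v => (s v).val ρ) := by
  classical
  rw [potential_eq_sum_mul, livingWeight, living, Finset.sum_filter, Finset.mul_sum]
  refine Finset.sum_le_sum fun v _ => ?_
  have hval : ∀ u, (s u).val ρ = if (s u).alive then ρ else 0 := fun u => by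
    simp [Pub.val, hs u]
  simp only [hval]
  rw [sum_conflict_mul]
  split_ifs with hv
  · have hle : (#{u | G.Adj v u ∧ (s u).alive ∧ (s v).layer ≤ (s u).layer ∧
        (s v).color ≠ (s u).color} : ℝ) ≤ d := by
      refine le_trans ?_ (hd v hv)
      rw [outDegree, countP_nbrStates, Nat.cast_le]
      refine Finset.card_le_card fun u hu => ?_
      simp only [Finset.mem_filter, Finset.mem_univ, true_and] at hu ⊢
      tauto
    have hw : (0 : ℝ) ≤ (s v).weight := by positivity
    have := mul_le_mul_of_nonneg_left hle (by positivity : 0 ≤ ρ * (lam * (s v).weight * ρ))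
    linarith
  · simp

open Classical in
theorem alive_dropStep (a : Pub) (M : Multiset Pub) :
    (dropStep lam a M).alive = true ↔ (a.alive = true ∧ a.choice = some true) ∧
      lam * M.countP (fun b => b.alive ∧ b.choice = some true ∧ a.layer ≤ b.layer ∧
        a.color ≠ b.color) < 1 := by
  simp [dropStep]

/-- A chosen node with k penalised conflicts contributes w(1 − lam·k), which is at most w if it
stays and at most 0 if it is dropped. -/
theorem potential_le_livingWeight_dropStep {s : V → Pub} {c : V → Pub} (hlam : 0 ≤ lam)
    (hc : ∀ v, ∃ o, c v = { s v with choice := o }) (hsome : ∀ v, (c v).choice ≠ none) :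
    potential (fun v => (s v).weight) (conflict G lam s) (fun v => (c v).val ρ) ≤
      livingWeight (runStep G (dropStep lam) c) := by
  classical
  rw [potential_eq_sum_mul, livingWeight, living, Finset.sum_filter]
  refine Finset.sum_le_sum fun v _ => ?_
  have hlayer : ∀ v, (c v).layer = (s v).layer := fun v => by
    obtain ⟨o, ho⟩ := hc v; rw [ho]
  have hcolor : ∀ v, (c v).color = (s v).color := fun v => by
    obtain ⟨o, ho⟩ := hc v; rw [ho]
  have hweight : ∀ v, (c v).weight = (s v).weight := fun v => by
    obtain ⟨o, ho⟩ := hc v; rw [ho]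
  have hval : ∀ u, (c u).val ρ = if (c u).alive ∧ (c u).choice = some true then 1 else 0 := by
    intro u
    rcases h : (c u).choice with _ | b
    · exact (hsome u h).elim
    · cases b <;> simp [Pub.val, h]
  simp only [hval]
  rw [sum_conflict_mul]
  have hw : (0 : ℝ) ≤ (s v).weight := by positivity
  have hcount : (nbrStates G c v).countP (fun b => b.alive ∧ b.choice = some true ∧
      (c v).layer ≤ b.layer ∧ (c v).color ≠ b.color) =
      #{u | G.Adj v u ∧ ((c u).alive ∧ (c u).choice = some true) ∧ (s v).layer ≤ (s u).layer ∧
        (s v).color ≠ (s u).color} := by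
    rw [countP_nbrStates]
    congr 1
    ext u
    simp only [Finset.mem_filter, Finset.mem_univ, true_and, hlayer, hcolor]
    tauto
  have halive : (runStep G (dropStep lam) c v).alive = true ↔
      ((c v).alive ∧ (c v).choice = some true) ∧
      lam * #{u | G.Adj v u ∧ ((c u).alive ∧ (c u).choice = some true) ∧
        (s v).layer ≤ (s u).layer ∧ (s v).color ≠ (s u).color} < 1 := by
    rw [← hcount]
    exact alive_dropStep _ _
  have hweight' : (runStep G (dropStep lam) c v).weight = (s v).weight := hweight v
  rw [hweight']
  set k : ℕ := #{u | G.Adj v u ∧ ((c u).alive ∧ (c u).choice = some true) ∧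
        (s v).layer ≤ (s u).layer ∧ (s v).color ≠ (s u).color} with hk
  have hk0 : (0 : ℝ) ≤ k := by positivity
  by_cases h1 : (c v).alive ∧ (c v).choice = some true
  · by_cases h2 : lam * k < 1
    · rw [if_pos h1, if_pos (halive.2 ⟨h1, h2⟩)]
      nlinarith [mul_nonneg (mul_nonneg hlam hk0) hw]
    · rw [if_pos h1, if_neg fun h => h2 (halive.1 h).2]
      nlinarith
  · rw [if_neg h1, if_neg fun h => h1 (halive.1 h).1]
    simp

/-- Thinning keeps a `ρ / 2` fraction of the weight, and reduces the out-degree from `d` to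
`2 * d * ρ + d / r`. -/
theorem run_thinning {s : V → Pub} (hm : 0 < m)
    (hcode : ∀ u v, G.Adj v u → #{i | code (s u).ident i = code (s v).ident i} * r ≤ m)
    (hd0 : 0 < d) (hρ : 0 < ρ) (hρ1 : ρ ≤ 1)
    (hd : ∀ v, (s v).alive → (outDegree G s v : ℝ) ≤ d) :
    (∀ v, (run G (thinning code d ρ) s v).ident = (s v).ident ∧
      (run G (thinning code d ρ) s v).weight = (s v).weight) ∧
    ρ / 2 * livingWeight s ≤ livingWeight (run G (thinning code d ρ) s) ∧
    ∀ v, (run G (thinning code d ρ) s v).alive → ∃ a b : ℕ,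
      outDegree G (run G (thinning code d ρ) s) v ≤ a + b ∧ (a : ℝ) < 2 * d * ρ ∧
        (b * r : ℝ) ≤ d := by
  classical
  set lam : ℝ := 1 / (2 * d * ρ) with hlam
  have hlam0 : 0 < lam := by positivity
  set s₁ := runStep G (colorStep code d) s with hs₁
  set c := run G ((List.range (m * 4 ^ r)).map (decideStep lam ρ)) s₁ with hc
  have hrun : run G (thinning code d ρ) s = runStep G (dropStep lam) c := by
    rw [thinning, run_cons, run_append]
    rfl
  have hnone : ∀ v, (s₁ v).choice = none := fun v => rfl
  have hprop := fun v => run_decideStep G (lam := lam) (ρ := ρ) s₁ hnone (m * 4 ^ r) v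
  rw [← hc] at hprop
  have hsome : ∀ v, (c v).choice ≠ none := fun v h =>
    ((hprop v).2.1 h).not_gt (color_colorStep_lt hm _ _)
  have hd₁ : ∀ v, (s₁ v).alive → (outDegree G s₁ v : ℝ) ≤ d := by
    intro v hv
    have : outDegree G s₁ v = outDegree G s v := by
      rw [outDegree, outDegree, countP_nbrStates, countP_nbrStates]
      rfl
    rw [this]
    exact hd v hv
  have hfield : ∀ v, (c v).ident = (s v).ident ∧ (c v).weight = (s v).weight ∧
      (c v).layer = (s v).layer ∧ (c v).alive = (s v).alive ∧ (c v).color = (s₁ v).color := by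
    intro v
    obtain ⟨⟨o, ho⟩, -⟩ := hprop v
    rw [ho]
    exact ⟨rfl, rfl, rfl, rfl, rfl⟩
  rw [hrun]
  refine ⟨fun v => ⟨(hfield v).1, (hfield v).2.1⟩, ?_, ?_⟩
  · refine le_trans ?_ ((potential_run_decideStep G (lam := lam) hρ.le hρ1 s₁ hnone
      (m * 4 ^ r)).trans (potential_le_livingWeight_dropStep G hlam0.le
        (fun v => (hprop v).1) hsome))
    refine le_trans (le_of_eq ?_) (le_potential_of_undecided G hlam0.le hρ.le s₁ hnone hd₁)
    have h1 : lam * d * ρ = 1 / 2 := by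
      rw [hlam]
      field_simp
    have h2 : livingWeight s₁ = livingWeight s := rfl
    rw [h1, h2]
    ring
  · intro v hv
    obtain ⟨⟨hal, -⟩, hlt⟩ := (alive_dropStep _ _).1 hv
    -- The drop rule bounds the out-neighbours of other colours, the code those of the same colour.
    -- Separate integer counts let the final thinning conclude that both are zero.
    refine ⟨(nbrStates G c v).countP (fun b => b.alive ∧ b.choice = some true ∧
      (c v).layer ≤ b.layer ∧ (c v).color ≠ b.color), _, ?_, ?_,
      card_same_color_le G hm hcode hd ((hfield v).2.2.2.1 ▸ hal)⟩
    · rw [outDegree, countP_nbrStates, countP_nbrStates]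
      refine (Finset.card_le_card fun u hu => ?_).trans (Finset.card_union_le _ _)
      obtain ⟨-, hadj, hu', hlay⟩ := Finset.mem_filter.1 hu
      obtain ⟨⟨hual, huch⟩, -⟩ := (alive_dropStep _ _).1 hu'
      change (c v).layer ≤ (c u).layer at hlay
      rw [Finset.mem_union, Finset.mem_filter, Finset.mem_filter]
      by_cases hcol : (c v).color = (c u).color
      · right
        refine ⟨Finset.mem_univ _, hadj, (hfield u).2.2.2.1 ▸ hual, ?_, ?_⟩
        · rw [← (hfield v).2.2.1, ← (hfield u).2.2.1]
          exact hlay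
        · rw [← (hfield v).2.2.2.2, ← (hfield u).2.2.2.2]
          exact hcol
      · left
        exact ⟨Finset.mem_univ _, hadj, hual, huch, hlay, hcol⟩
    · rw [hlam, one_div, inv_mul_lt_iff₀ (by positivity), mul_one] at hlt
      exact hlt

end Thinning


/-! ### Layering by distributed peeling -/

/-- In round `i` of the peeling, a surviving node with more than `d` surviving neighbours
survives. -/
def layerStep (d i : ℕ) : LocalStep Pub := fun a M =>
  if a.layer = i ∧ d < M.countP (fun b => b.layer = i) then { a with layer := i + 1 } else a

open Classical in
theorem run_layerStep {V : Type} [Fintype V] (G : SimpleGraph V) (d : ℕ) {s : V → Pub}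
    (hs : ∀ v, (s v).layer = 0) (i : ℕ) :
    ∃ l : V → ℕ, (∀ v, run G ((List.range i).map (layerStep d)) s v = { s v with layer := l v }) ∧
      (∀ v, l v ≤ i) ∧ (∀ v, l v = i ↔ v ∈ survivors G d i) ∧
      ∀ v, l v < i → #{u | G.Adj v u ∧ l v ≤ l u} ≤ d := by
  induction i with
  | zero =>
    exact ⟨fun _ => 0, fun v => congrArg (fun x => { s v with layer := x }) (hs v),
      fun v => le_rfl, by simp [survivors], by simp⟩
  | succ i ih =>
    obtain ⟨l, hl, hle, hmem, hdeg⟩ := ih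
    have hcount : ∀ v, (nbrStates G (run G ((List.range i).map (layerStep d)) s) v).countP
        (fun b => b.layer = i) = #{u ∈ survivors G d i | G.Adj v u} := by
      intro v
      rw [countP_nbrStates]
      congr 1
      ext u
      simp only [Finset.mem_filter, Finset.mem_univ, true_and, hl, hmem]
      tauto
    refine ⟨fun v => if v ∈ survivors G d (i + 1) then i + 1 else l v, fun v => ?_, fun v => ?_,
      fun v => ?_, fun v hv => ?_⟩
    · rw [run_range_succ]
      simp only [runStep, layerStep, hcount]
      simp only [hl, hmem, survivors, Finset.mem_filter]
      split_ifs <;> rfl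
    · simp only
      split_ifs
      · exact le_rfl
      · exact (hle v).trans (Nat.le_succ i)
    · simp only
      split_ifs with h
      · simp [h]
      · have := hle v
        simp only [h, iff_false]
        omega
    · have hv' : v ∉ survivors G d (i + 1) := fun h => by simp [h] at hv
      simp only [hv', if_false]
      -- Only nodes already in the top layer i rise, so comparisons with a node that stays behind
      -- are unaffected.
      have hiff : ∀ u, l v ≤ (if u ∈ survivors G d (i + 1) then i + 1 else l u) ↔ l v ≤ l u := by
        intro u
        split_ifs with h
        · have hu : l u = i := (hmem u).2 (Finset.mem_filter.1 h).1
          have := hle v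
          exact iff_of_true (by omega) (by omega)
        · rfl
      simp only [hiff]
      rcases (hle v).lt_or_eq with hlt | heq
      · exact hdeg v hlt
      · have hmem' : v ∈ survivors G d i := (hmem v).1 heq
        have hnot : ¬ d < #{u ∈ survivors G d i | G.Adj v u} := fun h =>
          hv' (Finset.mem_filter.2 ⟨hmem', h⟩)
        refine le_trans (Finset.card_le_card fun u hu => ?_) (not_lt.1 hnot)
        obtain ⟨-, hadj, hlu⟩ := Finset.mem_filter.1 hu
        refine Finset.mem_filter.2 ⟨(hmem u).1 (le_antisymm (hle u) ?_), hadj⟩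
        rw [← heq]
        exact hlu

theorem outDegree_run_layerStep {V : Type} [Fintype V] (G : SimpleGraph V) {d i : ℕ} {s : V → Pub}
    (hs : ∀ v, (s v).layer = 0) (hi : survivors G d i = ∅) (v : V) :
    outDegree G (run G ((List.range i).map (layerStep d)) s) v ≤ d := by
  classical
  obtain ⟨l, hl, hle, hmem, hdeg⟩ := run_layerStep G d hs i
  have hlt : l v < i := lt_of_le_of_ne (hle v) fun h => by
    have := (hmem v).1 h
    simp [hi] at this
  rw [outDegree, countP_nbrStates]
  refine (Finset.card_le_card fun u hu => ?_).trans (hdeg v hlt)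
  obtain ⟨-, hadj, -, hlay⟩ := Finset.mem_filter.1 hu
  rw [hl, hl] at hlay
  exact Finset.mem_filter.2 ⟨Finset.mem_univ _, hadj, hlay⟩

/-! ### Iterated thinning and the final independent set -/

section Thinnings

variable {V : Type} [Fintype V] (G : SimpleGraph V) {r m M : ℕ} {code : ℕ → Fin m → Fin (4 ^ r)}

theorem run_flatMap_range_succ {P : Type} (f : ℕ → List (LocalStep P)) (k : ℕ) (s : V → P) :
    run G ((List.range (k + 1)).flatMap f) s =
      run G (f k) (run G ((List.range k).flatMap f) s) := by
  rw [List.range_succ, List.flatMap_append, run_append]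
  simp

/-- Each thinning with probability `1 / (3 * M)` divides the out-degree by `M`. -/
theorem run_thinnings (hm : 0 < m) (hM : 0 < M) {s : V → Pub} {D : ℝ} (hD : 0 < D)
    (hcode : ∀ u v, G.Adj v u → #{i | code (s u).ident i = code (s v).ident i} * r ≤ m)
    (hr : r = 8 * M) (hd : ∀ v, (s v).alive → (outDegree G s v : ℝ) ≤ D) (k : ℕ) :
    let s' := run G ((List.range k).flatMap fun i => thinning code (D / M ^ i) (1 / (3 * M))) s
    (∀ v, (s' v).ident = (s v).ident ∧ (s' v).weight = (s v).weight) ∧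
      (1 / (6 * M)) ^ k * livingWeight s ≤ livingWeight s' ∧
      ∀ v, (s' v).alive → (outDegree G s' v : ℝ) ≤ D / M ^ k := by
  have hM' : (1 : ℝ) ≤ M := by exact_mod_cast hM
  induction k with
  | zero => simpa using hd
  | succ k ih =>
    intro s'
    obtain ⟨hfield, hweight, hdeg⟩ := ih
    obtain ⟨hfield', hweight', hdeg'⟩ := run_thinning G (code := code) (d := D / M ^ k)
      (ρ := 1 / (3 * M)) hm
      (fun u v h => by
        rw [(hfield u).1, (hfield v).1]
        exact hcode u v h)
      (by positivity) (by positivity) (by rw [div_le_one (by positivity)]; linarith) hdeg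
    rw [← run_flatMap_range_succ (f := fun i => thinning code (D / M ^ i) (1 / (3 * M)))]
      at hfield' hweight' hdeg'
    refine ⟨fun v => ⟨(hfield' v).1.trans (hfield v).1, (hfield' v).2.trans (hfield v).2⟩,
      le_trans ?_ hweight', fun v hv => ?_⟩
    · rw [pow_succ, mul_comm (_ ^ k), mul_assoc]
      have h6 : (1 : ℝ) / (3 * M) / 2 = 1 / (6 * M) := by
        rw [div_div]
        ring_nf
      rw [h6]
      gcongr
    · obtain ⟨a, b, hab, ha, hb⟩ := hdeg' v hv
      change outDegree G s' v ≤ a + b at hab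
      have hab' : (outDegree G s' v : ℝ) ≤ a + b := by
        rw [← Nat.cast_add]
        exact Nat.cast_le.2 hab
      have hx : D / M ^ (k + 1) = D / M ^ k / M := by rw [pow_succ, div_div]
      rw [hx]
      set x := D / M ^ k with hxdef
      have hx0 : 0 < x := by positivity
      -- The choices ρ = 1/(3M) and r = 8M give shares 2/3 and 1/8 of x/M, which sum to less than 1.
      have ha' : (a : ℝ) < 2 / 3 * (x / M) := by
        refine ha.trans_eq ?_
        field_simp
      have hb' : (b : ℝ) ≤ 1 / 8 * (x / M) := by
        rw [hr] at hb
        push_cast at hb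
        rw [← mul_div_assoc, le_div_iff₀ (by positivity)]
        linarith
      have : 0 < x / M := by positivity
      linarith

/-- Thinning with probability `1 / (2 * d)` leaves an independent set. -/
theorem run_thinning_isIndepSet (hm : 0 < m) {s : V → Pub} {d : ℝ} (hd1 : 1 ≤ d) (hdr : d < r)
    (hcode : ∀ u v, G.Adj v u → #{i | code (s u).ident i = code (s v).ident i} * r ≤ m)
    (hd : ∀ v, (s v).alive → (outDegree G s v : ℝ) ≤ d) :
    let s' := run G (thinning code d (1 / (2 * d))) s
    (∀ v, (s' v).weight = (s v).weight) ∧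
      1 / (4 * d) * livingWeight s ≤ livingWeight s' ∧ G.IsIndepSet (living s' : Set V) := by
  intro s'
  obtain ⟨hfield, hweight, hdeg⟩ := run_thinning G (code := code) (ρ := 1 / (2 * d)) hm hcode
    (by linarith) (by positivity) (by rw [div_le_one (by positivity)]; linarith) hd
  refine ⟨fun v => (hfield v).2, le_trans (le_of_eq ?_) hweight, ?_⟩
  · rw [div_div]
    ring_nf
  · have hzero : ∀ v, (s' v).alive → outDegree G s' v = 0 := by
      intro v hv
      obtain ⟨a, b, hab, ha, hb⟩ := hdeg v hv
      have ha' : (a : ℝ) < 1 := by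
        refine ha.trans_eq ?_
        field_simp
      have hb' : (b : ℝ) < 1 := by
        by_contra! h
        nlinarith
      rw [Nat.cast_lt_one] at ha' hb'
      change outDegree G s' v ≤ a + b at hab
      omega
    -- Layers are totally ordered, so of two living neighbours one is an out-neighbour of the other,
    -- against out-degree 0.
    have hle : ∀ u v, (s' u).alive → (s' v).alive → G.Adj u v →
        ¬ (s' u).layer ≤ (s' v).layer := by
      intro u v hu hv hadj hlay
      classical
      have h := hzero u hu
      rw [outDegree, countP_nbrStates, Finset.card_eq_zero] at h
      have : v ∈ (∅ : Finset V) := h ▸ Finset.mem_filter.2 ⟨Finset.mem_univ _, hadj, hv, hlay⟩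
      simp at this
    intro u hu v hv _ hadj
    have hu' : (s' u).alive := by simpa [living] using hu
    have hv' : (s' v).alive := by simpa [living] using hv
    rcases le_total (s' u).layer (s' v).layer with h | h
    · exact hle u v hu' hv' hadj h
    · exact hle v u hv' hu' hadj.symm h

end Thinnings

/-! ### Message length -/

namespace Pub

def encodeNat (a : Pub) : ℕ :=
  Nat.pair a.ident <| Nat.pair a.weight.num <| Nat.pair a.weight.den <| Nat.pair a.layer <|
    Nat.pair a.color <| Nat.pair a.alive.toNat (a.choice.elim 2 Bool.toNat)

theorem encodeNat_injective : Function.Injective encodeNat := by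
  rintro ⟨i, w, l, k, a, o⟩ ⟨i', w', l', k', a', o'⟩ h
  simp only [encodeNat, Nat.pair_eq_pair] at h
  obtain ⟨rfl, hn, hd, rfl, rfl, ha, ho⟩ := h
  obtain rfl : w = w' := NNRat.ext_num_den hn hd
  obtain rfl : a = a' := by cases a <;> cases a' <;> simp_all
  obtain rfl : o = o' := by
    rcases o with _ | _ | _ <;> rcases o' with _ | _ | _ <;> simp_all
  rfl

/-- The bit string that a node broadcasts. -/
def encode (a : Pub) : List Bool := a.encodeNat.bits

theorem encode_injective : Function.Injective encode := by
  intro a b h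
  have h' : a.encodeNat.bits = b.encodeNat.bits := h
  apply encodeNat_injective
  rw [← Nat.digits_inj_iff (b := 2), Nat.digits_two_eq_bits, Nat.digits_two_eq_bits, h']

/-- All numbers in a public state have at most `S` bits. -/
structure FitsIn (S : ℕ) (a : Pub) : Prop where
  ident : a.ident < 2 ^ S
  num : a.weight.num < 2 ^ S
  den : a.weight.den < 2 ^ S
  layer : a.layer < 2 ^ S
  color : a.color < 2 ^ S

theorem pair_lt_two_pow {a b s t : ℕ} (ha : a < 2 ^ s) (hb : b < 2 ^ t) (hst : s ≤ t) :
    Nat.pair a b < 2 ^ (2 * t) := by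
  refine (Nat.pair_lt_max_add_one_sq a b).trans_le ?_
  rw [mul_comm, pow_mul]
  have : (2 : ℕ) ^ s ≤ 2 ^ t := Nat.pow_le_pow_right two_pos hst
  exact Nat.pow_le_pow_left (max_lt (ha.trans_le this) hb) 2

/-- Each pairing at most doubles the bit bound, and six nested pairings give 2^6 = 64. The code 2 of
an undecided node fits because S ≥ 2. -/
theorem FitsIn.length_encode_le {S : ℕ} (hS : 2 ≤ S) {a : Pub} (h : a.FitsIn S) :
    a.encode.length ≤ 64 * S := by
  rw [encode, Nat.size_eq_bits_len, Nat.size_le]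
  have h4 : (2 : ℕ) ^ 2 ≤ 2 ^ S := Nat.pow_le_pow_right two_pos hS
  have halive : a.alive.toNat < 2 ^ S := by
    have := a.alive.toNat_le
    omega
  have hchoice : a.choice.elim 2 Bool.toNat < 2 ^ S := by
    rcases a.choice with _ | o
    · simp only [Option.elim]
      omega
    · have := o.toNat_le
      simp only [Option.elim]
      omega
  have h1 := pair_lt_two_pow halive hchoice le_rfl
  have h2 := pair_lt_two_pow h.color h1 (by omega)
  have h3 := pair_lt_two_pow h.layer h2 (by omega)
  have h4 := pair_lt_two_pow h.den h3 (by omega)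
  have h5 := pair_lt_two_pow h.num h4 (by omega)
  have h6 := pair_lt_two_pow h.ident h5 (by omega)
  refine h6.trans_eq ?_
  ring_nf

end Pub


section Validity

variable {S : ℕ}

theorem Pub.FitsIn.layerStep {d i : ℕ} (hi : i + 1 < 2 ^ S) {a : Pub} (M : Multiset Pub)
    (h : a.FitsIn S) : (layerStep d i a M).FitsIn S := by
  unfold Congest.layerStep
  split_ifs
  · exact ⟨h.ident, h.num, h.den, hi, h.color⟩
  · exact h

theorem Pub.FitsIn.thinning {r m : ℕ} {code : ℕ → Fin m → Fin (4 ^ r)} {d ρ : ℝ} (hm : 0 < m)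
    (hS : m * 4 ^ r ≤ 2 ^ S) {f : LocalStep Pub} (hf : f ∈ thinning code d ρ) {a : Pub}
    (M : Multiset Pub) (h : a.FitsIn S) : (f a M).FitsIn S := by
  rw [Congest.thinning, List.mem_cons, List.mem_append, List.mem_map, List.mem_singleton] at hf
  rcases hf with rfl | ⟨t, -, rfl⟩ | rfl
  · exact ⟨h.ident, h.num, h.den, h.layer, (color_colorStep_lt hm a M).trans_le hS⟩
  · unfold decideStep
    split_ifs
    · exact ⟨h.ident, h.num, h.den, h.layer, h.color⟩
    · exact h
  · exact ⟨h.ident, h.num, h.den, h.layer, h.color⟩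

end Validity

/-! ### Parameters, round count and approximation factor -/

/-- The out-degree of the layering on graphs of arboricity `α`. -/
def degreeBound (M α : ℕ) : ℕ := if α < M then 2 * α else 4 * α

/-- The length of the code words; identifiers are smaller than `2 ^ codeLength c n`. -/
def codeLength (c n : ℕ) : ℕ := (c + 1) * (Nat.log 2 n + 1)

noncomputable def identCode (r m : ℕ) : ℕ → Fin m → Fin (4 ^ r) := (exists_code r m).choose

/-- The maximum weight independent set program: compute a layering, thin out until the out-degree
is constant, and thin out once more to an independent set. -/
noncomputable def mwisProgram (M b c n α : ℕ) : List (LocalStep Pub) :=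
  (List.range (b * (Nat.log 2 n + 1))).map (layerStep (degreeBound M α)) ++
    ((List.range (Nat.log M α)).flatMap fun i =>
      thinning (identCode (8 * M) (codeLength c n)) (degreeBound M α / M ^ i) (1 / (3 * M))) ++
    thinning (identCode (8 * M) (codeLength c n)) (degreeBound M α / M ^ Nat.log M α)
      (1 / (2 * (degreeBound M α / M ^ Nat.log M α)))

def initialPub (i : LocalInput) : Pub := ⟨i.ident, i.weight, 0, 0, true, none⟩

/-- A bound on the number of bits of each number in a public state. -/
def numBits (M b c n : ℕ) : ℕ := (b + 16 * M + c + 3) * (Nat.log 2 n + 1)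

section Bounds

variable {M b c n α : ℕ}

theorem pow_lt_two_pow_codeLength : n ^ c < 2 ^ codeLength c n := by
  have h : n < 2 ^ (Nat.log 2 n + 1) := Nat.lt_pow_succ_log_self one_lt_two n
  calc n ^ c ≤ (2 ^ (Nat.log 2 n + 1)) ^ c := Nat.pow_le_pow_left h.le c
    _ = 2 ^ (c * (Nat.log 2 n + 1)) := by rw [← pow_mul, mul_comm]
    _ < 2 ^ codeLength c n := Nat.pow_lt_pow_right one_lt_two
        (Nat.mul_lt_mul_of_pos_right (Nat.lt_succ_self c) (Nat.succ_pos _))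

theorem codeLength_pos : 0 < codeLength c n := Nat.mul_pos (Nat.succ_pos _) (Nat.succ_pos _)

theorem mwisProgram_fitsIn {f : LocalStep Pub} (hf : f ∈ mwisProgram M b c n α) {a : Pub}
    (X : Multiset Pub) (h : a.FitsIn (numBits M b c n)) : (f a X).FitsIn (numBits M b c n) := by
  have hl : 1 ≤ Nat.log 2 n + 1 := Nat.succ_pos _
  have hcol : codeLength c n * 4 ^ (8 * M) ≤ 2 ^ numBits M b c n := by
    have h4 : (4 : ℕ) ^ (8 * M) = 2 ^ (16 * M) := by
      rw [show (4 : ℕ) = 2 ^ 2 by norm_num, ← pow_mul]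
      ring_nf
    rw [h4]
    refine (Nat.mul_le_mul_right _ (Nat.lt_two_pow_self (n := codeLength c n)).le).trans ?_
    rw [← pow_add]
    refine Nat.pow_le_pow_right two_pos ?_
    rw [codeLength, numBits]
    nlinarith
  rw [mwisProgram, List.mem_append, List.mem_append, List.mem_map, List.mem_flatMap] at hf
  rcases hf with (⟨i, hi, rfl⟩ | ⟨i, -, hf⟩) | hf
  · refine h.layerStep ?_ X
    rw [List.mem_range] at hi
    refine (Nat.lt_two_pow_self (n := i + 1)).trans_le (Nat.pow_le_pow_right two_pos ?_)
    rw [numBits]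
    nlinarith
  · exact h.thinning codeLength_pos hcol hf X
  · exact h.thinning codeLength_pos hcol hf X

theorem length_thinning {r m : ℕ} (code : ℕ → Fin m → Fin (4 ^ r)) (d ρ : ℝ) :
    (thinning code d ρ).length = m * 4 ^ r + 2 := by
  simp [thinning]

theorem length_mwisProgram : (mwisProgram M b c n α).length =
    b * (Nat.log 2 n + 1) + (Nat.log M α + 1) * (codeLength c n * 4 ^ (8 * M) + 2) := by
  simp only [mwisProgram, List.length_append, List.length_map, List.length_range,
    List.length_flatMap, length_thinning, List.map_const', List.sum_replicate, smul_eq_mul]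
  ring

theorem natLog_add_one_le {n : ℕ} (hn : 2 ≤ n) :
    ((Nat.log 2 n + 1 : ℕ) : ℝ) ≤ 2 * Real.logb 2 n := by
  have h1 : (1 : ℝ) ≤ Real.logb 2 n := by
    rw [Real.le_logb_iff_rpow_le one_lt_two (by positivity), Real.rpow_one]
    exact_mod_cast hn
  have h2 : (Nat.log 2 n : ℝ) ≤ Real.logb 2 n := by
    exact_mod_cast Real.natLog_le_logb n 2
  push_cast
  linarith

theorem length_mwisProgram_le (hM : 2 ≤ M) (hn : 2 ≤ n) (hα : 2 ≤ α) :
    ((mwisProgram M b c n α).length : ℝ) ≤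
      4 * (b + (c + 3) * 4 ^ (8 * M)) * Real.logb 2 α * Real.logb 2 n := by
  have h1 : (mwisProgram M b c n α).length ≤
      (b + (c + 3) * 4 ^ (8 * M)) * (Nat.log 2 α + 1) * (Nat.log 2 n + 1) := by
    rw [length_mwisProgram]
    have hk : Nat.log M α + 1 ≤ Nat.log 2 α + 1 :=
      Nat.succ_le_succ (Nat.log_anti_left one_lt_two hM)
    have h4 : 1 ≤ 4 ^ (8 * M) := Nat.one_le_pow _ _ (by norm_num)
    have hphase : codeLength c n * 4 ^ (8 * M) + 2 ≤
        (c + 3) * 4 ^ (8 * M) * (Nat.log 2 n + 1) := by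
      rw [codeLength]
      have : 1 * 1 ≤ 4 ^ (8 * M) * (Nat.log 2 n + 1) := Nat.mul_le_mul h4 (Nat.succ_pos _)
      nlinarith
    calc _ ≤ b * (Nat.log 2 α + 1) * (Nat.log 2 n + 1) +
          (Nat.log 2 α + 1) * ((c + 3) * 4 ^ (8 * M) * (Nat.log 2 n + 1)) := by
          gcongr
          exact Nat.le_mul_of_pos_right b (Nat.succ_pos _)
      _ = _ := by ring
  have h2 := natLog_add_one_le hn
  have h3 := natLog_add_one_le hα
  have h4 : 0 ≤ Real.logb 2 (α : ℝ) := by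
    have : (0 : ℝ) ≤ (Nat.log 2 α + 1 : ℕ) := Nat.cast_nonneg _
    linarith
  calc ((mwisProgram M b c n α).length : ℝ)
      ≤ (b + (c + 3) * 4 ^ (8 * M)) * (Nat.log 2 α + 1 : ℕ) * (Nat.log 2 n + 1 : ℕ) := by
        exact_mod_cast h1
    _ ≤ (b + (c + 3) * 4 ^ (8 * M)) * (2 * Real.logb 2 α) * (2 * Real.logb 2 n) := by
        gcongr
    _ = _ := by ring

theorem numBits_le (hn : 2 ≤ n) :
    ((64 * numBits M b c n : ℕ) : ℝ) ≤ 128 * (b + 16 * M + c + 3) * Real.logb 2 n := by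
  have h := natLog_add_one_le hn
  rw [numBits]
  push_cast at h ⊢
  have h0 : (0 : ℝ) ≤ b + 16 * M + c + 3 := by positivity
  nlinarith [mul_le_mul_of_nonneg_left h h0]

theorem fitsIn_initialPub {V : Type} [Fintype V] {N : Network V} (hN : N.HasLogBits c) (v : V) :
    (initialPub (N.input v)).FitsIn (numBits M b c (Fintype.card V)) := by
  obtain ⟨h1, h2, h3⟩ := hN v
  have h : Fintype.card V ^ c < 2 ^ numBits M b c (Fintype.card V) := by
    refine pow_lt_two_pow_codeLength.trans_le (Nat.pow_le_pow_right two_pos ?_)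
    rw [codeLength, numBits]
    gcongr <;> omega
  exact ⟨h1.trans_lt h, h2.trans_lt h, h3.trans_lt h, by simp [initialPub],
    by simp [initialPub]⟩

theorem two_le_numBits : 2 ≤ numBits M b c n := by
  have : 1 ≤ Nat.log 2 n + 1 := Nat.succ_pos _
  rw [numBits]
  nlinarith

theorem le_degreeBound : 2 * α ≤ degreeBound M α := by
  unfold degreeBound
  split_ifs <;> omega

/-- The peeling rate must be bounded away from 1 uniformly in α. The bound 2α achieves this only for
bounded α, hence 4α from M on. -/
theorem degreeBound_ratio_le (hM : 0 < M) :
    (2 * α / (degreeBound M α + 1) : ℝ) ≤ 2 * M / (2 * M + 1) := by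
  have hM' : (1 : ℝ) ≤ M := by exact_mod_cast hM
  rw [div_le_div_iff₀ (by positivity) (by positivity)]
  unfold degreeBound
  split_ifs with h
  · have : (α : ℝ) < M := by exact_mod_cast h
    push_cast
    nlinarith
  · have : (M : ℝ) ≤ α := by exact_mod_cast not_lt.1 h
    push_cast
    nlinarith

theorem two_le_degreeBound_div (hα : 0 < α) (hM : 0 < M) :
    (2 : ℝ) ≤ degreeBound M α / M ^ Nat.log M α := by
  have hM' : (0 : ℝ) < M := by exact_mod_cast hM
  rw [le_div_iff₀ (by positivity)]
  have h1 : M ^ Nat.log M α ≤ α := Nat.pow_log_le_self M hα.ne'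
  have h2 : (M : ℝ) ^ Nat.log M α ≤ α := by exact_mod_cast h1
  have h3 : (2 * α : ℝ) ≤ degreeBound M α := by exact_mod_cast le_degreeBound
  linarith

/-- The final thinning needs an out-degree below r = 8M, so that same-coloured out-neighbours
disappear. -/
theorem degreeBound_div_lt (hM : 1 < M) :
    (degreeBound M α / M ^ Nat.log M α : ℝ) < (8 * M : ℕ) := by
  have hM' : (0 : ℝ) < M := by exact_mod_cast (zero_lt_one.trans hM)
  rw [div_lt_iff₀ (by positivity)]
  have h1 : α < M ^ (Nat.log M α + 1) := Nat.lt_pow_succ_log_self hM α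
  have h2 : (α : ℝ) < M ^ (Nat.log M α + 1) := by exact_mod_cast h1
  have h3 : degreeBound M α ≤ 4 * α := by
    unfold degreeBound
    split_ifs <;> omega
  have h4 : (degreeBound M α : ℝ) ≤ 4 * α := by exact_mod_cast h3
  have h5 : (0 : ℝ) < M ^ (Nat.log M α + 1) := by positivity
  rw [pow_succ] at h2 h5
  push_cast
  nlinarith

/-- The approximation factor of the program. -/
theorem loss_le {τ : ℝ} (hτ : 0 < τ) (hM : 1 < M) (h6 : (6 : ℝ) ^ (2 / τ) ≤ M)
    (h16 : (16 : ℝ) ^ (2 / τ) ≤ M) (hα : (2 : ℝ) ^ (3 / τ) ≤ α) :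
    (4 * degreeBound M α * 6 ^ Nat.log M α : ℝ) ≤ (α : ℝ) ^ (1 + τ) := by
  have hα0 : (0 : ℝ) < α := lt_of_lt_of_le (by positivity) hα
  have hM0 : (0 : ℝ) < M := by exact_mod_cast (zero_lt_one.trans hM)
  have root : ∀ {x y q : ℝ}, 0 < x → 0 < q → x ^ (1 / q) ≤ y → x ≤ y ^ q := by
    intro x y q hx hq h
    calc x = (x ^ (1 / q)) ^ q := by
          rw [← Real.rpow_mul hx.le, one_div_mul_cancel hq.ne', Real.rpow_one]
      _ ≤ y ^ q := Real.rpow_le_rpow (by positivity) h hq.le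
  rw [Real.rpow_add hα0, Real.rpow_one]
  unfold degreeBound
  split_ifs with h
  -- Here k = 0 and the loss is 8α; the hypothesis α ≥ 2^(3/τ) says exactly that α^τ ≥ 8.
  · have h8 : (8 : ℝ) ≤ (α : ℝ) ^ τ := by
      refine root (by norm_num) hτ (le_trans (le_of_eq ?_) hα)
      rw [show (8 : ℝ) = 2 ^ (3 : ℝ) by norm_num, ← Real.rpow_mul (by norm_num), mul_one_div]
    rw [Nat.log_of_lt h, pow_zero]
    push_cast
    nlinarith
  -- One factor α^(τ/2) absorbs 16, since α ≥ M; the other absorbs 6^k, since 6 ≤ M^(τ/2) and M^k ≤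
  -- α.
  · have hMα : (M : ℝ) ≤ α := by exact_mod_cast not_lt.1 h
    have hpow : M ^ Nat.log M α ≤ α :=
      Nat.pow_log_le_self M (by exact_mod_cast hα0.ne')
    have hpow' : (M : ℝ) ^ Nat.log M α ≤ α := by exact_mod_cast hpow
    have hτ2 : 0 < τ / 2 := by positivity
    have ha : (16 : ℝ) ≤ (α : ℝ) ^ (τ / 2) :=
      root (by norm_num) hτ2 (by rw [one_div_div]; exact h16.trans hMα)
    have hb : (6 : ℝ) ^ Nat.log M α ≤ (α : ℝ) ^ (τ / 2) := by
      calc (6 : ℝ) ^ Nat.log M α ≤ ((M : ℝ) ^ (τ / 2)) ^ Nat.log M α :=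
            pow_le_pow_left₀ (by norm_num)
              (root (by norm_num) hτ2 (by rw [one_div_div]; exact h6)) _
        _ = ((M : ℝ) ^ Nat.log M α) ^ (τ / 2) := by
            rw [← Real.rpow_natCast, ← Real.rpow_natCast, ← Real.rpow_mul hM0.le,
              ← Real.rpow_mul hM0.le, mul_comm]
        _ ≤ (α : ℝ) ^ (τ / 2) := Real.rpow_le_rpow (by positivity) hpow' hτ2.le
    have hab : (16 : ℝ) * 6 ^ Nat.log M α ≤ (α : ℝ) ^ τ := by
      calc (16 : ℝ) * 6 ^ Nat.log M α ≤ (α : ℝ) ^ (τ / 2) * (α : ℝ) ^ (τ / 2) := by gcongr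
        _ = (α : ℝ) ^ τ := by rw [← Real.rpow_add hα0, add_halves]
    push_cast
    calc (4 * (4 * α) * 6 ^ Nat.log M α : ℝ) = α * (16 * 6 ^ Nat.log M α) := by ring
      _ ≤ α * (α : ℝ) ^ τ := by gcongr

end Bounds

/-! ### Assembling the algorithm -/

theorem run_mwisProgram {V : Type} [Fintype V] (N : Network V) {M b c α : ℕ} (hM : 1 < M)
    (hα : 0 < α) (hN : N.HasLogBits c) (hG : HasForestPartition N.graph α)
    (hb : (2 * M / (2 * M + 1) : ℝ) ^ b ≤ 1 / 2) :
    let s := run N.graph (mwisProgram M b c (Fintype.card V) α) fun v => initialPub (N.input v)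
    (∀ v, (s v).weight = N.weight v) ∧ N.graph.IsIndepSet (living s : Set V) ∧
      (∑ v, (N.weight v : ℝ)) ≤ 4 * degreeBound M α * 6 ^ Nat.log M α * livingWeight s := by
  classical
  intro s
  set s₀ : V → Pub := fun v => initialPub (N.input v) with hs₀
  set code := identCode (8 * M) (codeLength c (Fintype.card V)) with hcode
  set D : ℝ := ((degreeBound M α : ℕ) : ℝ) with hD
  set k := Nat.log M α with hk
  have hM0 : (0 : ℝ) < M := by exact_mod_cast (zero_lt_one.trans hM)
  have hD0 : 0 < D := by
    have : 0 < degreeBound M α := lt_of_lt_of_le (by omega) le_degreeBound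
    exact Nat.cast_pos.2 this
  set s₁ := run N.graph ((List.range (b * (Nat.log 2 (Fintype.card V) + 1))).map
    (layerStep (degreeBound M α))) s₀ with hs₁
  obtain ⟨l, hl, -⟩ := run_layerStep N.graph (degreeBound M α) (s := s₀) (fun v => rfl)
    (b * (Nat.log 2 (Fintype.card V) + 1))
  have hempty : survivors N.graph (degreeBound M α)
      (b * (Nat.log 2 (Fintype.card V) + 1)) = ∅ :=
    survivors_eq_empty hG ((pow_le_pow_left₀ (by positivity)
      (degreeBound_ratio_le (zero_lt_one.trans hM)) b).trans hb)
  have hdeg₁ : ∀ v, (s₁ v).alive → (outDegree N.graph s₁ v : ℝ) ≤ D := fun v _ =>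
    Nat.cast_le.2 (outDegree_run_layerStep N.graph (fun v => rfl) hempty v)
  have hident₁ : ∀ v, (s₁ v).ident = N.ident v := fun v => by rw [hs₁, hl]; rfl
  have hagree : ∀ u v, N.graph.Adj v u →
      #{i | code (N.ident u) i = code (N.ident v) i} * (8 * M) ≤
        codeLength c (Fintype.card V) := by
    intro u v huv
    refine (exists_code (8 * M) (codeLength c (Fintype.card V))).choose_spec _ ?_ _ ?_ ?_
    · exact (hN u).1.trans_lt pow_lt_two_pow_codeLength
    · exact (hN v).1.trans_lt pow_lt_two_pow_codeLength
    · exact fun h => N.graph.ne_of_adj huv (N.ident_injective h).symm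
  obtain ⟨hfield₂, hweight₂, hdeg₂⟩ := run_thinnings N.graph (code := code) codeLength_pos
    (zero_lt_one.trans hM) hD0 (fun u v h => by rw [hident₁, hident₁]; exact hagree u v h) rfl
    hdeg₁ k
  obtain ⟨hfield₃, hweight₃, hindep⟩ := run_thinning_isIndepSet N.graph (code := code)
    codeLength_pos (le_trans one_le_two (two_le_degreeBound_div hα (zero_lt_one.trans hM)))
    (degreeBound_div_lt hM)
    (fun u v h => by
      rw [(hfield₂ u).1, (hfield₂ v).1, hident₁, hident₁]
      exact hagree u v h) hdeg₂
  have hs : s = run N.graph (thinning code (D / M ^ k) (1 / (2 * (D / M ^ k))))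
      (run N.graph ((List.range k).flatMap fun i => thinning code (D / M ^ i) (1 / (3 * M)))
        s₁) := by
    change run N.graph (mwisProgram M b c (Fintype.card V) α) s₀ = _
    rw [mwisProgram, run_append, run_append]
  rw [← hs] at hfield₃ hweight₃ hindep
  refine ⟨fun v => ?_, hindep, ?_⟩
  · rw [hfield₃, (hfield₂ v).2, hs₁, hl]
    rfl
  · have htotal : livingWeight s₁ = ∑ v, (N.weight v : ℝ) := by
      rw [livingWeight, living, Finset.sum_filter]
      refine Finset.sum_congr rfl fun v _ => ?_
      rw [hs₁, hl]
      rfl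
    rw [← htotal]
    have hpos : (0 : ℝ) < 1 / (4 * (D / M ^ k)) := by positivity
    have h := (mul_le_mul_of_nonneg_left hweight₂ hpos.le).trans hweight₃
    -- The powers of M cancel: the weight lost to sampling is regained through the smaller final
    -- out-degree, leaving only 6^k.
    have hconst : 1 / (4 * (D / M ^ k)) * ((1 / (6 * M)) ^ k * livingWeight s₁) =
        livingWeight s₁ / (4 * D * 6 ^ k) := by
      rw [div_pow, mul_pow, one_pow]
      field_simp
    rw [hconst, div_le_iff₀ (by positivity)] at h
    linarith

theorem opt_le_sum {V : Type} [Fintype V] (G : SimpleGraph V) (w : V → ℚ≥0) :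
    opt G w ≤ ∑ v, w v :=
  Finset.sup_le fun _ _ => Finset.sum_le_sum_of_subset (Finset.subset_univ _)

end Congest

open Congest in
theorem mainTheorem1 (τ : ℝ) (hτ : 0 < τ) (c : ℕ) :
    ∃ (A : Congest.Algorithm) (B C : ℝ), A.IsCongest c B ∧
      ∀ (V : Type) [Fintype V] (N : Congest.Network V) (α : ℕ),
        N.HasLogBits c → Congest.arboricity N.graph = α → (2 : ℝ) ^ (3 / τ) ≤ (α : ℝ) →
          ∃ T : ℕ,
            (T : ℝ) ≤ C * Real.logb 2 (α : ℝ) * Real.logb 2 (Fintype.card V : ℝ) ∧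
            A.HaltsWithin N T ∧
            Congest.IsApproxMWIS N.graph N.weight ((α : ℝ) ^ (1 + τ)) (A.outputSet N T) := by
  -- M depends on τ alone, and b, the number of peeling rounds that halve the survivors, on M alone;
  -- so B and C depend only on τ and c.
  obtain ⟨M, hM2, hM6, hM16⟩ : ∃ M : ℕ, 2 ≤ M ∧ (6 : ℝ) ^ (2 / τ) ≤ M ∧
      (16 : ℝ) ^ (2 / τ) ≤ M := by
    obtain ⟨M, hM⟩ := exists_nat_ge (max 2 (max ((6 : ℝ) ^ (2 / τ)) ((16 : ℝ) ^ (2 / τ))))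
    simp only [max_le_iff] at hM
    exact ⟨M, by exact_mod_cast hM.1, hM.2⟩
  have hM1 : 1 < M := hM2
  obtain ⟨b, hb⟩ : ∃ b : ℕ, (2 * M / (2 * M + 1) : ℝ) ^ b < 1 / 2 :=
    exists_pow_lt_of_lt_one (by norm_num) (by rw [div_lt_one (by positivity)]; linarith)
  refine ⟨broadcast (mwisProgram M b c) initialPub Pub.encode
    (fun n => 64 * numBits M b c n) Pub.alive, 128 * (b + 16 * M + c + 3),
    4 * (b + (c + 3) * 4 ^ (8 * M)), broadcast_isCongest c fun n hn => numBits_le hn, ?_⟩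
  intro V _ N α hN hα hge
  have hα1 : 1 < α := by
    have : (1 : ℝ) < α :=
      (Real.one_lt_rpow one_lt_two (div_pos three_pos hτ)).trans_le hge
    exact_mod_cast this
  have hn : 2 ≤ Fintype.card V := one_lt_card_of_one_lt_arboricity (hα ▸ hα1)
  have hG : HasForestPartition N.graph α :=
    hα ▸ hasForestPartition_arboricity (hα ▸ zero_lt_one.trans hα1)
  have hlim : ∀ t v, (Pub.encode (run N.graph
      ((mwisProgram M b c (Fintype.card V) (arboricity N.graph)).take t)
      (fun v => initialPub (N.input v)) v)).length ≤ 64 * numBits M b c (Fintype.card V) := by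
    intro t v
    refine Pub.FitsIn.length_encode_le two_le_numBits ?_
    exact run_induction N.graph
      (fun f hf p X hp => mwisProgram_fitsIn (List.mem_of_mem_take hf) X hp)
      (fun v => fitsIn_initialPub hN v) v
  obtain ⟨hweight, hindep, htotal⟩ := run_mwisProgram N hM1 (zero_lt_one.trans hα1) hN hG hb.le
  refine ⟨(mwisProgram M b c (Fintype.card V) (arboricity N.graph)).length, ?_,
    broadcast_haltsWithin N Pub.encode_injective hlim, ?_⟩
  · rw [hα]
    exact length_mwisProgram_le hM2 hn hα1
  · have hout : (broadcast (mwisProgram M b c) initialPub Pub.encode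
        (fun n => 64 * numBits M b c n) Pub.alive).outputSet N
        (mwisProgram M b c (Fintype.card V) (arboricity N.graph)).length =
        living (run N.graph (mwisProgram M b c (Fintype.card V) α)
          fun v => initialPub (N.input v)) := by
      ext v
      rw [mem_broadcast_outputSet N Pub.encode_injective hlim, hα]
      simp [living]
    rw [hout]
    refine ⟨hindep, ?_⟩
    have h1 : ((opt N.graph N.weight : ℚ≥0) : ℝ) ≤ ∑ v, (N.weight v : ℝ) := by
      have := opt_le_sum N.graph N.weight
      exact_mod_cast this
    refine h1.trans (htotal.trans ?_)
    rw [livingWeight, NNRat.cast_sum]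
    simp only [hweight]
    exact mul_le_mul_of_nonneg_right (loss_le hτ hM1 hM6 hM16 hge)
      (Finset.sum_nonneg fun v _ => NNRat.cast_nonneg _)
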